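/- **Setting.** Let $d\ge 1$, and for $\mathbf k\in\mathbb Z^d$ let $|\mathbf k|=\max_v|k_v|$ and $\langle\mathbf k\rangle=\max\{1,|\mathbf k|\}$. Let $(\mathfrak B,\|\cdot\|_{\mathfrak B})$ be a translation invariant Banach algebra of complex sequences $(a_{\mathbf i})_{\mathbf i\in\mathbb Z^d}$ with pointwise operations: it contains the constant sequence $1$, with norm $1$, and is invariant under the translations $(\sigma_{\mathbf j}a)_{\mathbf i}=a_{\mathbf i-\mathbf j}$, which are isometries. A sequence $p\in\mathbb C^{\mathbb Z^d}$ (not necessarily in $\mathfrak B$) is $(\tau,\gamma)$-distal for $\mathfrak B$, written $p\in DC_{\mathfrak B}(\tau,\gamma)$, if for every $\mathbf k\ne\mathbf 0$ the sequence $\big((p_{\mathbf i}-p_{\mathbf i-\mathbf k})^{-1}\big)_{\mathbf i}$ is well defined, belongs to $\mathfrak B$ and has norm at most $\gamma^{-1}|\mathbf k|^{\tau}$. For a matrix $A=(a_{\mathbf i,\mathbf j})_{\mathbf i,\mathbf j\in\mathbb Z^d}$ with all diagonals $A_{\mathbf k}=(a_{\mathbf i,\mathbf i-\mathbf k})_{\mathbf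 i}$ in $\mathfrak B$ put $\|A\|_r^2=\sum_{\mathbf k}\|A_{\mathbf k}\|_{\mathfrak B}^2\langle\mathbf k\rangle^{2r}$, and let $\mathcal M_0^\infty$ be the set of diagonal matrices for which these norms are finite for all $r\ge0$. An operator on $\ell^2(\mathbb Z^d)$, possibly unbounded, has pure point spectrum if it has a complete set of eigenfunctions, i.e. one whose linear span is dense. **Theorem.** Fix $\alpha_0>d/2$, $\tau>0$, $\gamma>0$, $\delta>0$, $\eta>0$ and $s>\alpha_0+\tau+d/2+12\delta$, and put $\kappa=s-d/2-5\delta-\alpha_0$ (so $\kappa>0$). There are a constant $C=C(s,d,\delta,\tau,\alpha_0)>0$ and an $\epsilon_0=\epsilon_0(\eta,s,d,\delta,\tau,\gamma,\alpha_0)>0$ such that the following holds for every $\mathfrak B$ as above. Let $(T_\phi u)_{\mathbf i}=\sum_{\mathbf j}\phi_{\mathbf i-\mathbf j}u_{\mathbf j}$ with $\phi\in\mathbb R^{\mathbb Z^d}$, $\phi_{\mathbf 0}=0$ and $|\phi_{\mathbf i}|\le|\mathbf i|^{-s}$ for $\mathbf i\neq\mathbf 0$, and let $D=\mathrm{diag}(d_{\mathbf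 i})$ with $(d_{\mathbf i})\in DC_{\mathfrak B}(\tau,\gamma)$, $d_{\mathbf i}\in\mathbb C$. Assume further that $(p_{\mathbf i}+d_{\mathbf i})\in DC_{\mathfrak B}(\tau,\gamma)$ for each $P=\mathrm{diag}(p_{\mathbf i})\in\mathcal M_0^\infty$ with $\|P\|_0\le\eta$. If $\|T_\phi\|_{s-d/2-\delta}\le\epsilon_0$, then there is some $D'=\mathrm{diag}(d'_{\mathbf i})$ with $D'-D\in\mathcal M_0^\infty$, $$\|D-D'\|_0\le C\,\|T_\phi\|_{s-d/2-\delta},\qquad\text{and}\qquad \|D-D'\|_0\le C\,\|T_\phi\|_{s-d/2-\delta}^{1/\kappa}\quad\text{if }\kappa>\tfrac12,$$ such that $H=T_\phi+D$ (with domain $\{u\in\ell^2(\mathbb Z^d): (d_{\mathbf i}u_{\mathbf i})\in\ell^2(\mathbb Z^d)\}$) has pure point spectrum with a complete set of polynomially localized eigenfunctions $\{e_{\mathbf k}\}_{\mathbf k\in\mathbb Z^d}$, $He_{\mathbf k}=d'_{\mathbf k}e_{\mathbf k}$, satisfying $$|(e_{\mathbf k})_{\mathbf i}|\le 2\langle\mathbf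 i-\mathbf k\rangle^{-s+\tau+d/2+12\delta}\qquad\text{for all }\mathbf i,\mathbf k\in\mathbb Z^d.$$ Moreover, if $(d_{\mathbf i})$ is real-valued, then so is $(d'_{\mathbf i})$, and the spectrum of $H$ equals the closure of $\{d'_{\mathbf i}:\mathbf i\in\mathbb Z^d\}$ in $\mathbb R$. -/

import Mathlib

open scoped ENNReal

noncomputable section

namespace PowerLaw

/-- The lattice `ℤ^d`. Its norm `‖k‖` is the sup norm `max_v |k_v|`. -/
abbrev Lattice (d : ℕ) : Type := Fin d → ℤ

/-- The Hilbert space `ℓ²(ℤ^d)` of complex sequences. -/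
abbrev EllTwo (d : ℕ) : Type := lp (fun _ : Lattice d => ℂ) 2

/-- The Japanese bracket `⟨k⟩ = max {1, |k|}`. -/
def bracket {d : ℕ} (k : Lattice d) : ℝ := max 1 ‖k‖

/-- The translation `(σ_j a)_i = a_{i-j}`. -/
def translate {d : ℕ} (j : Lattice d) (a : Lattice d → ℂ) : Lattice d → ℂ :=
  fun i => a (i - j)

/-- A translation invariant Banach algebra of complex sequences on `ℤ^d`, with pointwise
operations: a unital subalgebra of `ℂ^(ℤ^d)` with a complete submultiplicative norm for which
the constant sequence `1` has norm one and all translations are isometries. -/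
structure SequenceAlgebra (d : ℕ) where
  /-- the sequences that belong to the algebra -/
  carrier : Subalgebra ℂ (Lattice d → ℂ)
  /-- the norm of the algebra -/
  nrm : AlgebraNorm ℂ carrier
  nrm_one : nrm 1 = 1
  complete : ∀ u : ℕ → carrier,
    (∀ ε : ℝ, 0 < ε → ∃ N : ℕ, ∀ m n : ℕ, N ≤ m → N ≤ n → nrm (u m - u n) < ε) →
    ∃ a : carrier, Filter.Tendsto (fun n => nrm (u n - a)) Filter.atTop (nhds 0)
  translate_mem : ∀ (j : Lattice d) (a : Lattice d → ℂ), a ∈ carrier → translate j a ∈ carrier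
  nrm_translate : ∀ (j : Lattice d) (a : Lattice d → ℂ) (ha : a ∈ carrier),
    nrm ⟨translate j a, translate_mem j a ha⟩ = nrm ⟨a, ha⟩

open Classical in
/-- The norm of the algebra as an extended real valued function of an arbitrary sequence; it
is `∞` exactly at the sequences outside the algebra. -/
def SequenceAlgebra.extNorm {d : ℕ} (B : SequenceAlgebra d) (a : Lattice d → ℂ) : ℝ≥0∞ :=
  if h : a ∈ B.carrier then ENNReal.ofReal (B.nrm ⟨a, h⟩) else ⊤

/-- `p` is a `(τ,γ)`-distal sequence for the algebra: for all `k ≠ 0` the differences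
`p_i - p_{i-k}` do not vanish, and the sequence of their inverses belongs to the algebra with
norm at most `γ⁻¹ |k|^τ`. -/
def IsDistal {d : ℕ} (B : SequenceAlgebra d) (τ γ : ℝ) (p : Lattice d → ℂ) : Prop :=
  ∀ k : Lattice d, k ≠ 0 →
    (∀ i, p i - p (i - k) ≠ 0) ∧
    ∃ h : (fun i => (p i - p (i - k))⁻¹) ∈ B.carrier,
      B.nrm ⟨fun i => (p i - p (i - k))⁻¹, h⟩ ≤ γ⁻¹ * ‖k‖ ^ τ

/-- Infinite matrices indexed by `ℤ^d`. -/
abbrev InfMatrix (d : ℕ) : Type := Lattice d → Lattice d → ℂ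

/-- The `k`-diagonal `A_k = (a_{i,i-k})_i`. -/
def kDiagonal {d : ℕ} (A : InfMatrix d) (k : Lattice d) : Lattice d → ℂ :=
  fun i => A i (i - k)

/-- The Sobolev norm `‖A‖_s = (∑_k ‖A_k‖² ⟨k⟩^{2s})^{1/2}`, as an extended real; it is `∞`
if some diagonal of `A` lies outside the algebra. -/
def sobolevNorm {d : ℕ} (B : SequenceAlgebra d) (s : ℝ) (A : InfMatrix d) : ℝ≥0∞ :=
  (∑' k : Lattice d, B.extNorm (kDiagonal A k) ^ 2 * ENNReal.ofReal (bracket k ^ (2 * s)))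
    ^ (1 / 2 : ℝ)

/-- The class `𝓜^s` of matrices of finite Sobolev norm. -/
def sobolevClass {d : ℕ} (B : SequenceAlgebra d) (s : ℝ) : Set (InfMatrix d) :=
  {A | sobolevNorm B s A < ⊤}

/-- The class `𝓜_0^∞` of diagonal matrices that lie in `𝓜^s` for every `s ≥ 0`. -/
def diagonalClass {d : ℕ} (B : SequenceAlgebra d) : Set (InfMatrix d) :=
  {A | (∀ s : ℝ, 0 ≤ s → A ∈ sobolevClass B s) ∧ ∀ i j, i ≠ j → A i j = 0}

/-- The diagonal matrix `diag (p_i)`. -/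
def diagMatrix {d : ℕ} (p : Lattice d → ℂ) : InfMatrix d :=
  fun i j => if i = j then p i else 0

/-- The matrix `(φ_{i-j})_{i,j}` of the hopping operator. -/
def hoppingMatrix {d : ℕ} (φ : Lattice d → ℝ) : InfMatrix d :=
  fun i j => (φ (i - j) : ℂ)

/-- The operator `(A u)_i = ∑_j a_{i,j} u_j` on `ℓ²(ℤ^d)` of an infinite matrix, with its
maximal domain: all `u` for which these series converge absolutely and `A u` is in `ℓ²`. -/
def matrixOperator {d : ℕ} (A : InfMatrix d) : EllTwo d →ₗ.[ℂ] EllTwo d where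
  domain :=
    { carrier := {u | (∀ i, Summable fun j => A i j * u j) ∧
        Memℓp (fun i => ∑' j, A i j * u j) 2}
      add_mem' := by
        rintro u v ⟨hu, hu'⟩ ⟨hv, hv'⟩
        have key : ∀ i j, A i j * (u + v) j = A i j * u j + A i j * v j := fun i j => by
          rw [lp.coeFn_add, Pi.add_apply, mul_add]
        refine ⟨fun i => ?_, ?_⟩
        · simpa only [key] using (hu i).add (hv i)
        · have : (fun i => ∑' j, A i j * (u + v) j) =
              (fun i => ∑' j, A i j * u j) + fun i => ∑' j, A i j * v j := by
            funext i
            simp only [key, Pi.add_apply]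
            exact (hu i).tsum_add (hv i)
          rw [this]
          exact hu'.add hv'
      zero_mem' := by
        refine ⟨fun i => ?_, ?_⟩
        · simp
        · have : (fun i => ∑' j, A i j * (0 : EllTwo d) j) = 0 := by
            funext i
            simp
          rw [this]
          exact zero_memℓp
      smul_mem' := by
        rintro c u ⟨hu, hu'⟩
        have key : ∀ i j, A i j * (c • u) j = c * (A i j * u j) := fun i j => by
          rw [lp.coeFn_smul, Pi.smul_apply, smul_eq_mul]; ring
        refine ⟨fun i => ?_, ?_⟩
        · simpa only [key] using (hu i).mul_left c
        · have : (fun i => ∑' j, A i j * (c • u) j) = c • fun i => ∑' j, A i j * u j := by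
            funext i
            simp only [key, Pi.smul_apply, smul_eq_mul]
            exact tsum_mul_left
          rw [this]
          exact hu'.const_smul c }
  toFun :=
    { toFun := fun u => ⟨fun i => ∑' j, A i j * (u : EllTwo d) j, u.2.2⟩
      map_add' := by
        rintro ⟨u, hu⟩ ⟨v, hv⟩
        ext i
        simp only [Submodule.coe_add, lp.coeFn_add, Pi.add_apply, mul_add]
        exact (hu.1 i).tsum_add (hv.1 i)
      map_smul' := by
        rintro c ⟨u, hu⟩
        ext i
        simp only [Submodule.coe_smul, lp.coeFn_smul, Pi.smul_apply, smul_eq_mul,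
          RingHom.id_apply, mul_left_comm _ c]
        exact tsum_mul_left }

/-- The operator `T_φ + D` with `D = diag (p_i)`, on the intersection of the domains of the two
summands. -/
def hamiltonian {d : ℕ} (φ : Lattice d → ℝ) (p : Lattice d → ℂ) : EllTwo d →ₗ.[ℂ] EllTwo d :=
  matrixOperator (hoppingMatrix φ) + matrixOperator (diagMatrix p)

/-- `e` is an eigenfunction of the (possibly unbounded) operator `H` with eigenvalue `μ`. -/
def IsEigenfunction {d : ℕ} (H : EllTwo d →ₗ.[ℂ] EllTwo d) (μ : ℂ) (e : EllTwo d) : Prop :=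
  e ≠ 0 ∧ ∃ h : e ∈ H.domain, H ⟨e, h⟩ = μ • e

/-- A set of vectors is complete if its linear span is dense in `ℓ²(ℤ^d)`. -/
def IsCompleteSet {d : ℕ} (S : Set (EllTwo d)) : Prop :=
  Dense (Submodule.span ℂ S : Set (EllTwo d))

/-- An operator has pure point spectrum if its eigenfunctions form a complete set. (This is the
definition used for operators that need not be normal.) -/
def HasPurePointSpectrum {d : ℕ} (H : EllTwo d →ₗ.[ℂ] EllTwo d) : Prop :=
  IsCompleteSet {e | ∃ μ : ℂ, IsEigenfunction H μ e}

/-- `z` is in the resolvent set of `H`: the map `H - z` from the domain of `H` to `ℓ²(ℤ^d)` is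
bijective with a bounded inverse `R`. -/
def InResolventSet {d : ℕ} (H : EllTwo d →ₗ.[ℂ] EllTwo d) (z : ℂ) : Prop :=
  ∃ R : EllTwo d →L[ℂ] EllTwo d,
    (∀ v, ∃ h : R v ∈ H.domain, H ⟨R v, h⟩ - z • R v = v) ∧
    ∀ u : H.domain, R (H u - z • (u : EllTwo d)) = u

/-- The spectrum of a (possibly unbounded) operator. -/
def operatorSpectrum {d : ℕ} (H : EllTwo d →ₗ.[ℂ] EllTwo d) : Set ℂ :=
  {z | ¬ InResolventSet H z}

end PowerLaw

end

open scoped ENNReal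

noncomputable section

namespace PowerLaw

/-! The aim is an invertible `V` close to `1` and a diagonal correction `q` with `(T + D) V = V (D +
diag q)`: the columns of `V` are then the eigenfunctions and `d' = d + q`. The operator `V` is a
limit of products of factors `1 + X`. If `(T + D) V = V (D + diag q + R)`, the diagonal of `R` is
moved into `q`, and `X` solves the commutator equation that removes the remaining diagonals of `R`
with `|k| ≤ N = 2^n`. Distality bounds the small divisors at a cost `|k|^τ ≤ N^τ`. The new remainder
is the tail of `R` beyond `N` plus terms quadratic in `R` and `X` (`conjugation_step`,
`exists_remainder`).

With `a = s - d/2 - δ` and `α = α₀`, the iteration keeps the `⟨k⟩^a` norm of `R` below `2ε` while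
its `⟨k⟩^α` norm is `O(ε N^{-(a-α)})`. The single weight `scaleWeight` records both facts, and its
norm is submultiplicative with a constant independent of `n`. The tail gains `N^{-(a-α)}` from the
high norm. The quadratic terms are of size `ε² N^τ N^{-2(a-α)}`, and `a > α + τ + 11δ` makes `N^τ
N^{-(a-α)}` at most `ρ^n` with `ρ = 2^{-11δ}`, hence summable (`IsApprox.step`,
`exists_limit_of_isApprox`). Since `T` has zero diagonal, `q` collects only quadratic terms and is
`O(ε²)`; both bounds on `D - D'` follow from this.

For the spectrum, the same construction applied to the transpose of `T` yields a complete family of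
left eigenfunctions. Pairing them with the right ones shows that the eigenvalues agree. Off the
closure of the eigenvalues, `V diag (1/(d' - z)) V⁻¹` is a right inverse of `H - z`, and
completeness of the left eigenfunctions makes `H - z` injective (`operatorSpectrum_hamiltonian`). -/

variable {d : ℕ}

/-! ### The Banach algebra of sequences and its extended norm. -/

namespace SequenceAlgebra

/-- The elements of the algebra, as a type that carries the norm of the algebra. -/
def Elt (B : SequenceAlgebra d) : Type := B.carrier

instance (B : SequenceAlgebra d) : CommRing B.Elt := inferInstanceAs (CommRing B.carrier)

instance (B : SequenceAlgebra d) : Algebra ℂ B.Elt := inferInstanceAs (Algebra ℂ B.carrier)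

instance (B : SequenceAlgebra d) : NormedCommRing B.Elt :=
  { RingNorm.toNormedRing (R := B.Elt) B.nrm.toRingNorm with
    mul_comm := mul_comm }

instance (B : SequenceAlgebra d) : NormedAlgebra ℂ B.Elt where
  norm_smul_le c a := (B.nrm.smul' c a).le

instance (B : SequenceAlgebra d) : NormOneClass B.Elt := ⟨B.nrm_one⟩

instance (B : SequenceAlgebra d) : CompleteSpace B.Elt := by
  refine Metric.complete_of_cauchySeq_tendsto fun u hu => ?_
  obtain ⟨a, ha⟩ := B.complete u fun ε hε => by
    obtain ⟨N, hN⟩ := Metric.cauchySeq_iff.1 hu ε hε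
    refine ⟨N, fun m n hm hn => ?_⟩
    have := hN m hm n hn
    rwa [dist_eq_norm] at this
  exact ⟨a, tendsto_iff_norm_sub_tendsto_zero.2 ha⟩

/-- The evaluation of the sequences in the algebra at a lattice point. -/
def evalHom (B : SequenceAlgebra d) (i : Lattice d) : B.Elt →ₐ[ℂ] ℂ :=
  (Pi.evalAlgHom ℂ (fun _ : Lattice d => ℂ) i).comp B.carrier.val

/-- A character of a Banach algebra is contractive. Hence the algebra embeds in `ℓ^∞`, which is what
turns matrices over it into operators on `ℓ²`. -/
lemma norm_evalHom_le (B : SequenceAlgebra d) (i : Lattice d) (a : B.Elt) :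
    ‖B.evalHom i a‖ ≤ ‖a‖ :=
  AlgHom.norm_apply_le_self (B.evalHom i) a

lemma continuous_evalHom (B : SequenceAlgebra d) (i : Lattice d) : Continuous (B.evalHom i) :=
  AddMonoidHomClass.continuous_of_bound (B.evalHom i) 1 fun a => by
    simpa using B.norm_evalHom_le i a

lemma extNorm_coe (B : SequenceAlgebra d) (a : B.Elt) :
    B.extNorm (fun i => B.evalHom i a) = ENNReal.ofReal ‖a‖ := by
  have h : (fun i => B.evalHom i a) ∈ B.carrier := a.2
  rw [extNorm, dif_pos h]
  rfl

lemma exists_elt (B : SequenceAlgebra d) {a : Lattice d → ℂ} (ha : B.extNorm a ≠ ⊤) :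
    ∃ b : B.Elt, (fun i => B.evalHom i b) = a ∧ B.extNorm a = ENNReal.ofReal ‖b‖ := by
  have h : a ∈ B.carrier := by
    by_contra h
    exact ha (dif_neg h)
  exact ⟨(⟨a, h⟩ : B.carrier), rfl, dif_pos h⟩

lemma extNorm_zero (B : SequenceAlgebra d) : B.extNorm 0 = 0 := by
  have := B.extNorm_coe 0
  simp only [map_zero, norm_zero, ENNReal.ofReal_zero] at this
  exact this

lemma extNorm_const (B : SequenceAlgebra d) (c : ℂ) :
    B.extNorm (fun _ => c) = ENNReal.ofReal ‖c‖ := by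
  have := B.extNorm_coe (algebraMap ℂ B.Elt c)
  simpa only [AlgHom.commutes, Algebra.algebraMap_self, RingHom.id_apply, norm_algebraMap']
    using this

lemma extNorm_mul_le (B : SequenceAlgebra d) (a b : Lattice d → ℂ) :
    B.extNorm (fun i => a i * b i) ≤ B.extNorm a * B.extNorm b := by
  by_cases ha : B.extNorm a = ⊤
  -- Because `∞ * 0 = 0`, a factor of norm zero must be treated apart: it is the zero sequence, so
  -- the product vanishes too.
  · by_cases hb : B.extNorm b = 0
    · obtain ⟨b', rfl, hb'⟩ := B.exists_elt (hb.trans_ne ENNReal.zero_ne_top)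
      have : b' = 0 := by
        rw [hb'] at hb
        exact norm_le_zero_iff.1 (ENNReal.ofReal_eq_zero.1 hb)
      have h : (fun i => a i * B.evalHom i b') = 0 := by
        funext i
        simp [this]
      rw [h, extNorm_zero]
      exact zero_le
    · rw [ha, ENNReal.top_mul hb]
      exact le_top
  by_cases hb : B.extNorm b = ⊤
  · by_cases ha' : B.extNorm a = 0
    · obtain ⟨b', rfl, hb'⟩ := B.exists_elt ha
      have : b' = 0 := by
        rw [hb'] at ha'
        exact norm_le_zero_iff.1 (ENNReal.ofReal_eq_zero.1 ha')
      have h : (fun i => B.evalHom i b' * b i) = 0 := by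
        funext i
        simp [this]
      rw [h, extNorm_zero]
      exact zero_le
    · rw [hb, ENNReal.mul_top ha']
      exact le_top
  obtain ⟨a, rfl, ha⟩ := B.exists_elt ha
  obtain ⟨b, rfl, hb⟩ := B.exists_elt hb
  rw [ha, hb, ← ENNReal.ofReal_mul (norm_nonneg _)]
  have := B.extNorm_coe (a * b)
  simp only [map_mul] at this
  rw [this]
  exact ENNReal.ofReal_le_ofReal (norm_mul_le a b)

lemma extNorm_translate_le (B : SequenceAlgebra d) (j : Lattice d) (a : Lattice d → ℂ) :
    B.extNorm (translate j a) ≤ B.extNorm a := by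
  by_cases ha : a ∈ B.carrier
  · rw [extNorm, extNorm, dif_pos ha, dif_pos (B.translate_mem j a ha), B.nrm_translate j a ha]
  · rw [extNorm, extNorm, dif_neg ha]
    exact le_top

lemma extNorm_neg (B : SequenceAlgebra d) (a : Lattice d → ℂ) : B.extNorm (-a) = B.extNorm a := by
  have key : ∀ b : Lattice d → ℂ, B.extNorm (-b) ≤ B.extNorm b := fun b => by
    have h := B.extNorm_mul_le (fun _ => -1) b
    rw [extNorm_const] at h
    have e : (fun i => (-1 : ℂ) * b i) = -b := by
      funext i
      simp
    rw [e] at h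
    simpa using h
  refine le_antisymm (key a) ?_
  simpa using key (-a)

/-- The extended norm is countably subadditive for pointwise convergent series. -/
lemma extNorm_le_tsum (B : SequenceAlgebra d) {ι : Type*} {a : ι → Lattice d → ℂ}
    {b : Lattice d → ℂ} (h : ∀ i, HasSum (fun n => a n i) (b i)) :
    B.extNorm b ≤ ∑' n, B.extNorm (a n) := by
  by_cases ht : ∑' n, B.extNorm (a n) = ⊤
  · rw [ht]
    exact le_top
  choose c hc hc' using fun n => B.exists_elt (ENNReal.ne_top_of_tsum_ne_top ht n)
  have hs : Summable fun n => ‖c n‖ := by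
    have h1 : ∑' n, ENNReal.ofReal ‖c n‖ ≠ ⊤ := by simpa only [hc'] using ht
    have := ENNReal.summable_toReal h1
    simpa only [ENNReal.toReal_ofReal (norm_nonneg _)] using this
  -- The series converges absolutely in the complete algebra, and continuity of the evaluations
  -- identifies its sum with the pointwise sum.
  have hb : b = fun i => B.evalHom i (∑' n, c n) := by
    funext i
    have h1 := (hs.of_norm.hasSum).map (B.evalHom i) (B.continuous_evalHom i)
    refine (h i).unique ?_
    convert h1 using 2 with n
    rw [← hc n]
    rfl
  rw [hb, extNorm_coe]
  simp only [hc']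
  rw [← ENNReal.ofReal_tsum_of_nonneg (fun _ => norm_nonneg _) hs]
  exact ENNReal.ofReal_le_ofReal (norm_tsum_le_tsum_norm hs)

lemma extNorm_add_le (B : SequenceAlgebra d) (a b : Lattice d → ℂ) :
    B.extNorm (a + b) ≤ B.extNorm a + B.extNorm b := by
  have := B.extNorm_le_tsum (a := fun n : Fin 2 => if n = 0 then a else b) (b := a + b) fun i => by
    have := hasSum_fintype (fun n : Fin 2 => (if n = 0 then a else b) i)
    simpa [Fin.sum_univ_two] using this
  simpa [tsum_fintype, Fin.sum_univ_two] using this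

lemma ofReal_norm_le_extNorm (B : SequenceAlgebra d) (a : Lattice d → ℂ) (i : Lattice d) :
    ENNReal.ofReal ‖a i‖ ≤ B.extNorm a := by
  by_cases ha : B.extNorm a = ⊤
  · rw [ha]
    exact le_top
  obtain ⟨a, rfl, ha⟩ := B.exists_elt ha
  rw [ha]
  exact ENNReal.ofReal_le_ofReal (B.norm_evalHom_le i a)

lemma norm_le_of_extNorm_le (B : SequenceAlgebra d) {a : Lattice d → ℂ} {x : ℝ} (hx : 0 ≤ x)
    (h : B.extNorm a ≤ ENNReal.ofReal x) (i : Lattice d) : ‖a i‖ ≤ x :=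
  (ENNReal.ofReal_le_ofReal_iff hx).1 ((B.ofReal_norm_le_extNorm a i).trans h)

end SequenceAlgebra

lemma IsDistal.extNorm_inv_le {B : SequenceAlgebra d} {τ γ : ℝ} {p : Lattice d → ℂ}
    (hp : IsDistal B τ γ p) {k : Lattice d} (hk : k ≠ 0) :
    B.extNorm (fun i => (p i - p (i - k))⁻¹) ≤ ENNReal.ofReal (γ⁻¹ * ‖k‖ ^ τ) := by
  obtain ⟨-, h, h'⟩ := hp k hk
  rw [SequenceAlgebra.extNorm, dif_pos h]
  exact ENNReal.ofReal_le_ofReal h'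

/-! ### Bounded operators on `ℓ²` and their matrices. -/

/-- The standard basis of `ℓ²(ℤ^d)`. -/
def unitVec (j : Lattice d) : EllTwo d := lp.single 2 j (1 : ℂ)

lemma unitVec_apply (i j : Lattice d) : unitVec j i = if i = j then 1 else 0 := by
  classical
  rw [unitVec, lp.single_apply]
  by_cases h : i = j
  · subst h; simp
  · simp [h]

lemma norm_unitVec (j : Lattice d) : ‖unitVec j‖ = 1 := by
  rw [unitVec, lp.norm_single (by norm_num)]
  simp

lemma hasSum_unitVec (u : EllTwo d) : HasSum (fun j => u j • unitVec j) u := by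
  have := lp.hasSum_single (p := 2) (by norm_num) u
  convert this using 2 with j
  rw [unitVec, ← lp.single_smul]
  simp

/-- The coordinates as continuous linear functionals. -/
def coord (i : Lattice d) : EllTwo d →L[ℂ] ℂ :=
  LinearMap.mkContinuous
    { toFun := fun u => u i
      map_add' := fun u v => by rw [lp.coeFn_add, Pi.add_apply]
      map_smul' := fun c u => by rw [lp.coeFn_smul, Pi.smul_apply, RingHom.id_apply] } 1
    fun u => by simpa using lp.norm_apply_le_norm (by norm_num) u i

lemma coord_apply (i : Lattice d) (u : EllTwo d) : coord i u = u i := rfl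

/-- The infinite matrix of a bounded operator. -/
def mat (A : EllTwo d →L[ℂ] EllTwo d) : InfMatrix d := fun i j => A (unitVec j) i

lemma hasSum_mat_mul (A : EllTwo d →L[ℂ] EllTwo d) (u : EllTwo d) (i : Lattice d) :
    HasSum (fun j => mat A i j * u j) (A u i) := by
  have := (hasSum_unitVec u).mapL ((coord i).comp A)
  simp only [map_smul, ContinuousLinearMap.comp_apply, coord_apply, smul_eq_mul] at this
  convert this using 2 with j
  rw [mul_comm, mat]

lemma mat_injective : Function.Injective (mat (d := d)) := by
  intro A B h
  ext u i
  have hA := hasSum_mat_mul A u i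
  rw [h] at hA
  exact hA.unique (hasSum_mat_mul B u i)

lemma hasSum_mat_comp (A B : EllTwo d →L[ℂ] EllTwo d) (i k : Lattice d) :
    HasSum (fun j => mat A i j * mat B j k) (mat (A * B) i k) :=
  hasSum_mat_mul A (B (unitVec k)) i

lemma mat_add (A B : EllTwo d →L[ℂ] EllTwo d) (i j : Lattice d) :
    mat (A + B) i j = mat A i j + mat B i j := by
  simp [mat]

lemma mat_sub (A B : EllTwo d →L[ℂ] EllTwo d) (i j : Lattice d) :
    mat (A - B) i j = mat A i j - mat B i j := by
  simp [mat]

lemma mat_neg (A : EllTwo d →L[ℂ] EllTwo d) (i j : Lattice d) :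
    mat (-A) i j = -mat A i j := by
  simp [mat]

lemma mat_one (i j : Lattice d) :
    mat (1 : EllTwo d →L[ℂ] EllTwo d) i j = if i = j then 1 else 0 := by
  simp [mat, unitVec_apply]

/-- Matrix entries depend continuously on the operator. -/
lemma continuous_mat (i j : Lattice d) :
    Continuous fun A : EllTwo d →L[ℂ] EllTwo d => mat A i j :=
  ((coord i).continuous).comp (ContinuousLinearMap.apply ℂ (EllTwo d) (unitVec j)).continuous

lemma hasSum_mat {ι : Type*} {A : ι → EllTwo d →L[ℂ] EllTwo d} {S : EllTwo d →L[ℂ] EllTwo d}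
    (h : HasSum A S) (i j : Lattice d) : HasSum (fun n => mat (A n) i j) (mat S i j) := by
  have := h.mapL ((coord i).comp (ContinuousLinearMap.apply ℂ (EllTwo d) (unitVec j)))
  exact this

/-- The operator with a single bounded diagonal, in position `k`. -/
lemma exists_diagonal_operator (k : Lattice d) (x : Lattice d → ℂ) (c : ℝ) (hx : ∀ i, ‖x i‖ ≤ c) :
    ∃ A : EllTwo d →L[ℂ] EllTwo d,
      (∀ u i, A u i = x i * u (i - k)) ∧ ‖A‖ ≤ c := by
  have hc : 0 ≤ c := (norm_nonneg _).trans (hx 0)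
  have h2 : (0 : ℝ) < (2 : ℝ≥0∞).toReal := by norm_num
  have hsum : ∀ u : EllTwo d, Summable fun i => ‖u (i - k)‖ ^ (2 : ℝ≥0∞).toReal := fun u =>
    (lp.hasSum_norm h2 u).summable.comp_injective (sub_left_injective (b := k))
  have hle : ∀ (u : EllTwo d) i, ‖x i * u (i - k)‖ ^ (2 : ℝ≥0∞).toReal ≤
      c ^ (2 : ℝ≥0∞).toReal * ‖u (i - k)‖ ^ (2 : ℝ≥0∞).toReal := fun u i => by
    rw [norm_mul, Real.mul_rpow (norm_nonneg _) (norm_nonneg _)]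
    gcongr
    exact hx i
  have hmem : ∀ u : EllTwo d, Memℓp (fun i => x i * u (i - k)) 2 := fun u =>
    memℓp_gen (.of_nonneg_of_le (fun i => by positivity) (hle u) ((hsum u).mul_left _))
  refine ⟨LinearMap.mkContinuous
    { toFun := fun u => ⟨fun i => x i * u (i - k), hmem u⟩
      map_add' := fun u v => by
        ext i
        simp only [lp.coeFn_add, Pi.add_apply, mul_add]
      map_smul' := fun a u => by
        ext i
        simp [mul_left_comm] } c fun u => ?_, fun u i => rfl, LinearMap.mkContinuous_norm_le _ hc _⟩
  refine lp.norm_le_of_tsum_le h2 (by positivity) ?_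
  have e : ∑' i, ‖u (i - k)‖ ^ (2 : ℝ≥0∞).toReal = ‖u‖ ^ (2 : ℝ≥0∞).toReal := by
    rw [lp.norm_rpow_eq_tsum h2]
    exact (Equiv.subRight k).tsum_eq fun i => ‖u i‖ ^ (2 : ℝ≥0∞).toReal
  rw [Real.mul_rpow hc (norm_nonneg _), ← e, ← tsum_mul_left]
  exact (Summable.of_nonneg_of_le (fun i => by positivity) (hle u)
    ((hsum u).mul_left _)).tsum_le_tsum (hle u) ((hsum u).mul_left _)

/-- A matrix whose diagonals have summable suprema is the matrix of a bounded operator. -/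
lemma exists_operator_of_summable (a : InfMatrix d) (c : Lattice d → ℝ) (hc : Summable c)
    (ha : ∀ k i, ‖kDiagonal a k i‖ ≤ c k) :
    ∃ A : EllTwo d →L[ℂ] EllTwo d, mat A = a ∧ ‖A‖ ≤ ∑' k, c k := by
  choose A hA hA' using fun k => exists_diagonal_operator k (kDiagonal a k) (c k) (ha k)
  have hs : Summable fun k => ‖A k‖ := .of_nonneg_of_le (fun _ => norm_nonneg _) hA' hc
  refine ⟨∑' k, A k, ?_, (norm_tsum_le_tsum_norm hs).trans (hs.tsum_le_tsum hA' hc)⟩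
  funext i j
  refine (hasSum_mat hs.of_norm.hasSum i j).unique ?_
  have e : ∀ k, mat (A k) i j = if k = i - j then a i j else 0 := fun k => by
    rw [mat, hA, unitVec_apply, kDiagonal]
    by_cases h : k = i - j
    · subst h; simp
    · have : i - k ≠ j := fun h' => h (by rw [← h']; abel)
      simp [h, this]
  simp only [e]
  exact hasSum_ite_eq _ _

/-! ### Matrices with real entries. -/

/-- All entries of the matrix are real. -/
def IsRealMatrix (a : InfMatrix d) : Prop := ∀ i j, (a i j).im = 0

lemma im_eq_zero_of_hasSum {ι : Type*} {f : ι → ℂ} {z : ℂ} (h : HasSum f z)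
    (hf : ∀ n, (f n).im = 0) : z.im = 0 := by
  have := Complex.hasSum_im h
  simp only [hf] at this
  exact this.unique hasSum_zero

lemma IsRealMatrix.mul {A B : EllTwo d →L[ℂ] EllTwo d} (hA : IsRealMatrix (mat A))
    (hB : IsRealMatrix (mat B)) : IsRealMatrix (mat (A * B)) := fun i k =>
  im_eq_zero_of_hasSum (hasSum_mat_comp A B i k) fun j => by
    rw [Complex.mul_im, hA, hB]; simp

lemma IsRealMatrix.add {A B : EllTwo d →L[ℂ] EllTwo d} (hA : IsRealMatrix (mat A))
    (hB : IsRealMatrix (mat B)) : IsRealMatrix (mat (A + B)) := fun i k => by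
  rw [mat_add, Complex.add_im, hA, hB, add_zero]

lemma IsRealMatrix.sub {A B : EllTwo d →L[ℂ] EllTwo d} (hA : IsRealMatrix (mat A))
    (hB : IsRealMatrix (mat B)) : IsRealMatrix (mat (A - B)) := fun i k => by
  rw [mat_sub, Complex.sub_im, hA, hB, sub_zero]

lemma IsRealMatrix.neg {A : EllTwo d →L[ℂ] EllTwo d} (hA : IsRealMatrix (mat A)) :
    IsRealMatrix (mat (-A)) := fun i k => by
  rw [mat_neg, Complex.neg_im, hA, neg_zero]

lemma isRealMatrix_one : IsRealMatrix (mat (1 : EllTwo d →L[ℂ] EllTwo d)) := fun i k => by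
  rw [mat_one]; split_ifs <;> simp

lemma IsRealMatrix.pow {A : EllTwo d →L[ℂ] EllTwo d} (hA : IsRealMatrix (mat A)) (n : ℕ) :
    IsRealMatrix (mat (A ^ n)) := by
  induction n with
  | zero => simpa using isRealMatrix_one
  | succ n ih => rw [pow_succ]; exact ih.mul hA

lemma isRealMatrix_of_hasSum {ι : Type*} {A : ι → EllTwo d →L[ℂ] EllTwo d}
    {S : EllTwo d →L[ℂ] EllTwo d} (h : HasSum A S) (hA : ∀ n, IsRealMatrix (mat (A n))) :
    IsRealMatrix (mat S) := fun i j =>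
  im_eq_zero_of_hasSum (hasSum_mat h i j) fun n => hA n i j

/-! ### The `ℓ²` norm for families in `[0, ∞]`. -/

section EllNorm

variable {ι κ : Type*}

/-- The `ℓ²` norm of a family of extended nonnegative reals. -/
def ellNorm (F : ι → ℝ≥0∞) : ℝ≥0∞ := (∑' k, F k ^ 2) ^ (1 / 2 : ℝ)

lemma rpow_half_sq (x : ℝ≥0∞) : (x ^ 2) ^ (1 / 2 : ℝ) = x := by
  rw [← ENNReal.rpow_natCast, ← ENNReal.rpow_mul]
  norm_num

lemma ellNorm_mono {F G : ι → ℝ≥0∞} (h : ∀ k, F k ≤ G k) : ellNorm F ≤ ellNorm G :=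
  ENNReal.rpow_le_rpow (ENNReal.tsum_le_tsum fun k => pow_le_pow_left' (h k) 2) (by norm_num)

lemma le_ellNorm (F : ι → ℝ≥0∞) (k : ι) : F k ≤ ellNorm F := by
  conv_lhs => rw [← rpow_half_sq (F k)]
  exact ENNReal.rpow_le_rpow (ENNReal.le_tsum k) (by norm_num)

lemma ellNorm_const_mul (c : ℝ≥0∞) (F : ι → ℝ≥0∞) :
    ellNorm (fun k => c * F k) = c * ellNorm F := by
  simp only [ellNorm, mul_pow, ENNReal.tsum_mul_left]
  rw [ENNReal.mul_rpow_of_nonneg _ _ (by norm_num), rpow_half_sq]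

lemma ellNorm_comp_equiv (e : κ ≃ ι) (F : ι → ℝ≥0∞) : ellNorm (fun k => F (e k)) = ellNorm F := by
  rw [ellNorm, ellNorm, e.tsum_eq fun k => F k ^ 2]

lemma tsum_mul_le_ellNorm (F G : ι → ℝ≥0∞) : ∑' k, F k * G k ≤ ellNorm F * ellNorm G := by
  rw [ENNReal.tsum_eq_iSup_sum]
  refine iSup_le fun s => (ENNReal.inner_le_Lp_mul_Lq s F G Real.HolderConjugate.two_two).trans ?_
  simp only [ENNReal.rpow_two]
  exact mul_le_mul' (ENNReal.rpow_le_rpow (ENNReal.sum_le_tsum s) (by norm_num))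
    (ENNReal.rpow_le_rpow (ENNReal.sum_le_tsum s) (by norm_num))

/-- Minkowski's inequality for countable sums. -/
lemma ellNorm_tsum_le (F : κ → ι → ℝ≥0∞) :
    ellNorm (fun k => ∑' m, F m k) ≤ ∑' m, ellNorm (F m) := by
  have key : ∑' k, (∑' m, F m k) ^ 2 ≤ (∑' m, ellNorm (F m)) ^ 2 := by
    calc ∑' k, (∑' m, F m k) ^ 2
        = ∑' k, ∑' m, ∑' n, F m k * F n k := by
          refine tsum_congr fun k => ?_
          rw [sq, ← ENNReal.tsum_mul_right]
          exact tsum_congr fun m => ENNReal.tsum_mul_left.symm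
      _ = ∑' m, ∑' n, ∑' k, F m k * F n k := by
          rw [ENNReal.tsum_comm]
          exact tsum_congr fun m => ENNReal.tsum_comm
      _ ≤ ∑' m, ∑' n, ellNorm (F m) * ellNorm (F n) :=
          ENNReal.tsum_le_tsum fun m => ENNReal.tsum_le_tsum fun n => tsum_mul_le_ellNorm _ _
      _ = (∑' m, ellNorm (F m)) ^ 2 := by
          rw [sq, ← ENNReal.tsum_mul_right]
          exact tsum_congr fun m => ENNReal.tsum_mul_left
  rw [← rpow_half_sq (∑' m, ellNorm (F m))]
  exact ENNReal.rpow_le_rpow key (by norm_num)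

lemma ellNorm_add_le (F G : ι → ℝ≥0∞) :
    ellNorm (fun k => F k + G k) ≤ ellNorm F + ellNorm G := by
  have := ellNorm_tsum_le fun n : Fin 2 => if n = 0 then F else G
  simpa [tsum_fintype, Fin.sum_univ_two] using this

end EllNorm

/-! ### Weighted matrix norms and their algebra property. -/

/-- The weighted norm `(∑_k ‖A_k‖² w(k)²)^{1/2}` of an infinite matrix. -/
def wNorm (B : SequenceAlgebra d) (w : Lattice d → ℝ) (a : InfMatrix d) : ℝ≥0∞ :=
  ellNorm fun k => B.extNorm (kDiagonal a k) * ENNReal.ofReal (w k)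

/-- The power weight `⟨k⟩^s`. -/
def powWeight (s : ℝ) (k : Lattice d) : ℝ := bracket k ^ s

lemma one_le_bracket (k : Lattice d) : 1 ≤ bracket k := le_max_left _ _

lemma bracket_pos (k : Lattice d) : 0 < bracket k := zero_lt_one.trans_le (one_le_bracket k)

lemma norm_le_bracket (k : Lattice d) : ‖k‖ ≤ bracket k := le_max_right _ _

lemma bracket_zero : bracket (0 : Lattice d) = 1 := by simp [bracket]

lemma bracket_neg (k : Lattice d) : bracket (-k) = bracket k := by simp [bracket]

lemma one_le_norm {k : Lattice d} (hk : k ≠ 0) : 1 ≤ ‖k‖ := by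
  obtain ⟨v, hv⟩ := Function.ne_iff.1 hk
  refine le_trans ?_ (norm_le_pi_norm k v)
  rw [Int.norm_eq_abs]
  exact_mod_cast Int.one_le_abs hv

lemma bracket_eq_norm {k : Lattice d} (hk : k ≠ 0) : bracket k = ‖k‖ :=
  max_eq_right (one_le_norm hk)

lemma bracket_add_le (m n : Lattice d) : bracket (m + n) ≤ bracket m + bracket n := by
  refine max_le ?_ ((norm_add_le m n).trans (add_le_add (norm_le_bracket m) (norm_le_bracket n)))
  linarith [one_le_bracket m, one_le_bracket n]

lemma powWeight_pos (s : ℝ) (k : Lattice d) : 0 < powWeight s k :=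
  Real.rpow_pos_of_pos (bracket_pos k) s

lemma powWeight_mono {s t : ℝ} (h : s ≤ t) (k : Lattice d) : powWeight s k ≤ powWeight t k :=
  Real.rpow_le_rpow_of_exponent_le (one_le_bracket k) h

lemma one_le_powWeight {s : ℝ} (hs : 0 ≤ s) (k : Lattice d) : 1 ≤ powWeight s k :=
  Real.one_le_rpow (one_le_bracket k) hs

/-- The sum is at most twice the larger bracket. The constant is stated with an upper bound `t` for
the exponent, so that one constant serves all exponents up to `t`. -/
lemma powWeight_add_le {s t : ℝ} (hs : 0 ≤ s) (hst : s ≤ t) (m n : Lattice d) :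
    powWeight s (m + n) ≤ 2 ^ t * (powWeight s m + powWeight s n) := by
  have hm := (bracket_pos m).le
  have hn := (bracket_pos n).le
  have h1 : bracket (m + n) ≤ 2 * max (bracket m) (bracket n) := by
    linarith [bracket_add_le m n, le_max_left (bracket m) (bracket n),
      le_max_right (bracket m) (bracket n)]
  have h2 : max (bracket m) (bracket n) ^ s ≤ powWeight s m + powWeight s n := by
    rcases max_cases (bracket m) (bracket n) with ⟨h, -⟩ | ⟨h, -⟩ <;> rw [h]
    · exact le_add_of_nonneg_right (powWeight_pos s n).le
    · exact le_add_of_nonneg_left (powWeight_pos s m).le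
  calc powWeight s (m + n) ≤ (2 * max (bracket m) (bracket n)) ^ s :=
        Real.rpow_le_rpow (bracket_pos _).le h1 hs
    _ = 2 ^ s * max (bracket m) (bracket n) ^ s :=
        Real.mul_rpow (by norm_num) (le_max_of_le_left hm)
    _ ≤ 2 ^ t * (powWeight s m + powWeight s n) :=
        mul_le_mul (Real.rpow_le_rpow_of_exponent_le (by norm_num) hst) h2 (by positivity)
          (by positivity)

lemma sobolevNorm_eq_wNorm (B : SequenceAlgebra d) (s : ℝ) (a : InfMatrix d) :
    sobolevNorm B s a = wNorm B (powWeight s) a := by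
  rw [sobolevNorm, wNorm, ellNorm]
  congr 2
  funext k
  rw [mul_pow, ← ENNReal.ofReal_pow (powWeight_pos s k).le, powWeight, ← Real.rpow_natCast,
    ← Real.rpow_mul (bracket_pos k).le]
  congr 3
  push_cast
  ring

lemma extNorm_le_wNorm (B : SequenceAlgebra d) (w : Lattice d → ℝ) (a : InfMatrix d)
    (k : Lattice d) :
    B.extNorm (kDiagonal a k) * ENNReal.ofReal (w k) ≤ wNorm B w a :=
  le_ellNorm (fun k => B.extNorm (kDiagonal a k) * ENNReal.ofReal (w k)) k

lemma wNorm_le_mul (B : SequenceAlgebra d) {w w' : Lattice d → ℝ} {a a' : InfMatrix d} {c : ℝ≥0∞}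
    (h : ∀ k, B.extNorm (kDiagonal a k) * ENNReal.ofReal (w k) ≤
      c * (B.extNorm (kDiagonal a' k) * ENNReal.ofReal (w' k))) :
    wNorm B w a ≤ c * wNorm B w' a' := by
  rw [wNorm, wNorm, ← ellNorm_const_mul]
  exact ellNorm_mono h

lemma wNorm_le_tsum (B : SequenceAlgebra d) (w : Lattice d → ℝ) {ι : Type*}
    {a : ι → InfMatrix d} {b : InfMatrix d} (h : ∀ i j, HasSum (fun n => a n i j) (b i j)) :
    wNorm B w b ≤ ∑' n, wNorm B w (a n) := by
  refine le_trans (ellNorm_mono fun k => ?_) (ellNorm_tsum_le _)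
  rw [ENNReal.tsum_mul_right]
  gcongr
  exact B.extNorm_le_tsum fun i => h i (i - k)

lemma wNorm_add_le (B : SequenceAlgebra d) (w : Lattice d → ℝ) (a b : InfMatrix d) :
    wNorm B w (a + b) ≤ wNorm B w a + wNorm B w b := by
  refine le_trans (ellNorm_mono fun k => ?_) (ellNorm_add_le _ _)
  rw [← add_mul]
  gcongr
  exact B.extNorm_add_le _ _

lemma wNorm_neg (B : SequenceAlgebra d) (w : Lattice d → ℝ) (a : InfMatrix d) :
    wNorm B w (-a) = wNorm B w a := by
  have : ∀ k, kDiagonal (-a) k = -kDiagonal a k := fun k => rfl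
  simp only [wNorm, this, B.extNorm_neg]

lemma wNorm_sub_le (B : SequenceAlgebra d) (w : Lattice d → ℝ) (a b : InfMatrix d) :
    wNorm B w (a - b) ≤ wNorm B w a + wNorm B w b := by
  rw [sub_eq_add_neg, ← wNorm_neg B w b]
  exact wNorm_add_le B w a (-b)

/-- The diagonals of a product are a twisted convolution, `(ab)_k = ∑_m a_m · σ_m b_{k-m}`;
translations being isometric, the norms obey an ordinary convolution bound. -/
lemma extNorm_kDiagonal_mul_le (B : SequenceAlgebra d) (a b : EllTwo d →L[ℂ] EllTwo d)
    (k : Lattice d) :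
    B.extNorm (kDiagonal (mat (a * b)) k) ≤
      ∑' m, B.extNorm (kDiagonal (mat a) m) * B.extNorm (kDiagonal (mat b) (k - m)) := by
  have h : ∀ i, HasSum (fun m => kDiagonal (mat a) m i * translate m (kDiagonal (mat b) (k - m)) i)
      (kDiagonal (mat (a * b)) k i) := fun i => by
    have := hasSum_mat_comp a b i (i - k)
    rw [← (Equiv.subLeft i).hasSum_iff] at this
    change HasSum _ (mat (a * b) i (i - k))
    convert this using 2 with m
    simp only [Function.comp_apply, Equiv.subLeft_apply, kDiagonal, translate]
    congr 2
    abel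
  refine (B.extNorm_le_tsum h).trans (ENNReal.tsum_le_tsum fun m => ?_)
  exact (B.extNorm_mul_le _ _).trans (mul_le_mul_right (B.extNorm_translate_le _ _) _)

/-- The square root of `∑_k ⟨k⟩^{-2α}`. -/
def embConst (d : ℕ) (α : ℝ) : ℝ≥0∞ :=
  ellNorm fun k : Lattice d => ENNReal.ofReal (powWeight (-α) k)

/-- Reduced to the summability of `‖x‖^s` over the lattice spanned by the standard basis of `ℝ^d`,
whose norm is the same sup norm. -/
lemma summable_powWeight {s : ℝ} (hs : s < -(d : ℝ)) :
    Summable fun k : Lattice d => powWeight s k := by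
  let L := Submodule.span ℤ (Set.range (Pi.basisFun ℝ (Fin d)))
  have hfin : Module.finrank ℤ L = d := by
    rw [ZLattice.rank ℝ L]; simp
  have h1 : Summable fun x : L => ‖x‖ ^ s := ZLattice.summable_norm_rpow L s (by rwa [hfin])
  let f : Lattice d → L := fun k => ⟨fun v => (k v : ℝ), by
    refine ((Pi.basisFun ℝ (Fin d)).mem_span_iff_repr_mem ℤ _).2 fun v => ?_
    exact ⟨k v, by simp⟩⟩
  have hf : Function.Injective f := fun k l h => by
    funext v
    have : (k v : ℝ) = l v := congrFun (congrArg Subtype.val h) v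
    exact_mod_cast this
  have hn : ∀ k, ‖f k‖ = ‖k‖ := fun k => by
    refine le_antisymm ((pi_norm_le_iff_of_nonneg (norm_nonneg _)).2 fun v => ?_)
      ((pi_norm_le_iff_of_nonneg (norm_nonneg _)).2 fun v => ?_)
    · exact (Int.norm_cast_real (k v)).le.trans (norm_le_pi_norm k v)
    · exact (Int.norm_cast_real (k v)).ge.trans (norm_le_pi_norm (f k : Fin d → ℝ) v)
  have h2 := h1.comp_injective hf
  -- At the origin the bracket is `1` but the norm is `0`, so the two series are compared off the
  -- origin.
  rw [← Finset.summable_compl_iff {0}] at h2 ⊢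
  refine h2.congr fun k => ?_
  have hk : (k : Lattice d) ≠ 0 := by simpa using k.2
  simp only [Function.comp_apply, hn, powWeight, bracket_eq_norm hk]

lemma embConst_ne_top {α : ℝ} (hα : (d : ℝ) / 2 < α) : embConst d α ≠ ⊤ := by
  have h := summable_powWeight (d := d) (s := -(2 * α)) (by linarith)
  refine ENNReal.rpow_ne_top_of_nonneg (by norm_num) ?_
  have e : ∀ k : Lattice d, ENNReal.ofReal (powWeight (-α) k) ^ 2 =
      ENNReal.ofReal (powWeight (-(2 * α)) k) := fun k => by
    rw [← ENNReal.ofReal_pow (powWeight_pos _ k).le, powWeight, ← Real.rpow_natCast,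
      ← Real.rpow_mul (bracket_pos k).le, powWeight]
    congr 2
    push_cast
    ring
  simp only [e]
  rw [← ENNReal.ofReal_tsum_of_nonneg (fun k => (powWeight_pos _ k).le) h]
  exact ENNReal.ofReal_ne_top

/-- Cauchy–Schwarz against `⟨k⟩^{-α}`, whose `ℓ²` norm is finite for `α > d/2`. -/
lemma tsum_extNorm_le (B : SequenceAlgebra d) {α : ℝ} {w : Lattice d → ℝ}
    (hw : ∀ k, powWeight α k ≤ w k) (a : InfMatrix d) :
    ∑' k, B.extNorm (kDiagonal a k) ≤ embConst d α * wNorm B w a := by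
  refine le_trans (ENNReal.tsum_le_tsum fun k => ?_) (tsum_mul_le_ellNorm _ _)
  have h1 : 1 ≤ powWeight (-α) k * w k := by
    rw [powWeight, Real.rpow_neg (bracket_pos k).le, ← div_eq_inv_mul]
    exact (one_le_div (powWeight_pos α k)).2 (hw k)
  rw [mul_left_comm, ← ENNReal.ofReal_mul (powWeight_pos _ k).le]
  exact le_mul_of_one_le_right' (ENNReal.one_le_ofReal.2 h1)

/-- Weights for which the matrices of finite weighted norm form an algebra. -/
structure IsAlgWeight (α c : ℝ) (w : Lattice d → ℝ) : Prop where
  le : ∀ k, powWeight α k ≤ w k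
  add_le : ∀ m n, w (m + n) ≤ c * (w m + w n)

lemma isAlgWeight_powWeight {α s t : ℝ} (hα : 0 ≤ α) (hs : α ≤ s) (hst : s ≤ t) :
    IsAlgWeight α (2 ^ t) (powWeight s : Lattice d → ℝ) :=
  ⟨powWeight_mono hs, powWeight_add_le (hα.trans hs) hst⟩

/-- The constant does not depend on `l`; this makes all product estimates of the iteration uniform
in the scale. -/
lemma isAlgWeight_add {α s l : ℝ} (hα : 0 ≤ α) (hs : α ≤ s) (hl : 0 ≤ l) :
    IsAlgWeight α (2 ^ s) (fun k : Lattice d => powWeight α k + l * powWeight s k) := by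
  refine ⟨fun k => le_add_of_nonneg_right (mul_nonneg hl (powWeight_pos s k).le), fun m n => ?_⟩
  have h1 := powWeight_add_le hα hs m n
  have h2 := mul_le_mul_of_nonneg_left (powWeight_add_le (hα.trans hs) le_rfl m n) hl
  calc _ ≤ _ := add_le_add h1 h2
    _ = _ := by ring

/-- The constant in the algebra property of weighted norms. -/
def algConst (d : ℕ) (α c : ℝ) : ℝ := 2 * c * (embConst d α).toReal + (embConst d α).toReal + 1

lemma one_le_algConst {α c : ℝ} (hc : 0 ≤ c) : 1 ≤ algConst d α c := by
  unfold algConst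
  have := (embConst d α).toReal_nonneg
  nlinarith [mul_nonneg hc this]

section Algebra

variable {B : SequenceAlgebra d} {α c : ℝ} {w : Lattice d → ℝ}

/-- The weight at `k` is split between `m` and `k - m`. Each of the two convolutions is then bounded
by Young's inequality `ℓ¹ * ℓ² → ℓ²`, the `ℓ¹` factor being controlled by `tsum_extNorm_le`. -/
lemma wNorm_mul_le (hα : (d : ℝ) / 2 < α) (hc : 0 ≤ c) (hw : IsAlgWeight α c w)
    (a b : EllTwo d →L[ℂ] EllTwo d) :
    wNorm B w (mat (a * b)) ≤
      ENNReal.ofReal (algConst d α c) * (wNorm B w (mat a) * wNorm B w (mat b)) := by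
  set f := fun k => B.extNorm (kDiagonal (mat a) k) with hf
  set g := fun k => B.extNorm (kDiagonal (mat b) k) with hg
  set W := fun k => ENNReal.ofReal (w k) with hW
  have hw0 : ∀ k, 0 ≤ w k := fun k => (powWeight_pos α k).le.trans (hw.le k)
  have hWadd : ∀ k m, W k ≤ ENNReal.ofReal c * (W m + W (k - m)) := fun k m => by
    have := hw.add_le m (k - m)
    rw [add_sub_cancel] at this
    rw [hW, ← ENNReal.ofReal_add (hw0 _) (hw0 _), ← ENNReal.ofReal_mul hc]
    exact ENNReal.ofReal_le_ofReal this
  have h1 : wNorm B w (mat (a * b)) ≤ ellNorm fun k => ENNReal.ofReal c *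
      (∑' m, g m * (f (k - m) * W (k - m)) + ∑' m, f m * (g (k - m) * W (k - m))) := by
    refine ellNorm_mono fun k => ?_
    have e : ∑' m, g m * (f (k - m) * W (k - m)) = ∑' m, f m * W m * g (k - m) := by
      rw [← (Equiv.subLeft k).tsum_eq]
      refine tsum_congr fun m => ?_
      simp only [Equiv.subLeft_apply, sub_sub_cancel]
      ring
    rw [e, ← ENNReal.tsum_add, ← ENNReal.tsum_mul_left]
    calc _ ≤ (∑' m, f m * g (k - m)) * W k := mul_le_mul_left (extNorm_kDiagonal_mul_le B a b k) _
      _ = ∑' m, f m * g (k - m) * W k := ENNReal.tsum_mul_right.symm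
      _ ≤ _ := ENNReal.tsum_le_tsum fun m => by
          calc _ ≤ f m * g (k - m) * (ENNReal.ofReal c * (W m + W (k - m))) :=
                mul_le_mul_right (hWadd k m) _
            _ = _ := by ring
  have young : ∀ f g : Lattice d → ℝ≥0∞, ellNorm (fun k => ∑' m, f m * g (k - m)) ≤
      (∑' m, f m) * ellNorm g := fun f g => by
    refine (ellNorm_tsum_le fun m k => f m * g (k - m)).trans ?_
    rw [← ENNReal.tsum_mul_right]
    refine ENNReal.tsum_le_tsum fun m => ?_
    rw [ellNorm_const_mul]
    exact mul_le_mul_right (ellNorm_comp_equiv (Equiv.subRight m) g).le _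
  have hE : embConst d α = ENNReal.ofReal (embConst d α).toReal :=
    (ENNReal.ofReal_toReal (embConst_ne_top hα)).symm
  rw [ellNorm_const_mul] at h1
  have h2 := h1.trans (mul_le_mul_right ((ellNorm_add_le _ _).trans
    (add_le_add (young g fun k => f k * W k) (young f fun k => g k * W k))) _)
  refine h2.trans ?_
  have hfs : ∑' m, f m ≤ _ := tsum_extNorm_le B hw.le (mat a)
  have hgs : ∑' m, g m ≤ _ := tsum_extNorm_le B hw.le (mat b)
  calc _ ≤ ENNReal.ofReal c * (embConst d α * wNorm B w (mat b) * wNorm B w (mat a)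
          + embConst d α * wNorm B w (mat a) * wNorm B w (mat b)) := by
        gcongr <;> exact le_rfl
    _ = ENNReal.ofReal (2 * c * (embConst d α).toReal) *
          (wNorm B w (mat a) * wNorm B w (mat b)) := by
        rw [ENNReal.ofReal_mul (by positivity), ENNReal.ofReal_mul (by positivity), ← hE]
        simp only [ENNReal.ofReal_ofNat]
        ring
    _ ≤ _ := by
        gcongr
        unfold algConst
        linarith [(embConst d α).toReal_nonneg]

lemma wNorm_mul_le_ofReal (hα : (d : ℝ) / 2 < α) (hc : 0 ≤ c) (hw : IsAlgWeight α c w)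
    {a b : EllTwo d →L[ℂ] EllTwo d} {x y : ℝ} (hx : 0 ≤ x)
    (ha : wNorm B w (mat a) ≤ ENNReal.ofReal x) (hb : wNorm B w (mat b) ≤ ENNReal.ofReal y) :
    wNorm B w (mat (a * b)) ≤ ENNReal.ofReal (algConst d α c * (x * y)) := by
  refine (wNorm_mul_le hα hc hw a b).trans ?_
  rw [ENNReal.ofReal_mul (zero_le_one.trans (one_le_algConst hc)), ENNReal.ofReal_mul hx]
  gcongr

/-- A matrix of finite weighted norm is the matrix of a bounded operator. -/
lemma exists_operator_of_wNorm_le (hα : (d : ℝ) / 2 < α) (hc : 0 ≤ c)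
    (hw : ∀ k, powWeight α k ≤ w k) {a : InfMatrix d} {x : ℝ} (hx : 0 ≤ x)
    (ha : wNorm B w a ≤ ENNReal.ofReal x) :
    ∃ A : EllTwo d →L[ℂ] EllTwo d, mat A = a ∧ ‖A‖ ≤ algConst d α c * x := by
  have h1 : ∑' k, B.extNorm (kDiagonal a k) ≤ ENNReal.ofReal (algConst d α c * x) := by
    refine (tsum_extNorm_le B hw a).trans ?_
    rw [ENNReal.ofReal_mul (zero_le_one.trans (one_le_algConst hc))]
    refine mul_le_mul' ?_ ha
    rw [← ENNReal.ofReal_toReal (embConst_ne_top hα)]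
    refine ENNReal.ofReal_le_ofReal ?_
    have := (embConst d α).toReal_nonneg
    unfold algConst
    nlinarith [mul_nonneg hc this]
  have h2 := h1.trans_lt ENNReal.ofReal_lt_top
  obtain ⟨A, hA, hA'⟩ := exists_operator_of_summable a
    (fun k => (B.extNorm (kDiagonal a k)).toReal) (ENNReal.summable_toReal h2.ne) fun k i =>
      (ENNReal.ofReal_le_iff_le_toReal (ENNReal.ne_top_of_tsum_ne_top h2.ne k)).1
        (B.ofReal_norm_le_extNorm _ i)
  refine ⟨A, hA, hA'.trans ?_⟩
  rw [← ENNReal.tsum_toReal_eq (ENNReal.ne_top_of_tsum_ne_top h2.ne)]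
  exact ENNReal.toReal_le_of_le_ofReal
    (mul_nonneg (zero_le_one.trans (one_le_algConst hc)) hx) h1

lemma norm_le_of_wNorm_le (hα : (d : ℝ) / 2 < α) (hc : 0 ≤ c)
    (hw : ∀ k, powWeight α k ≤ w k) {A : EllTwo d →L[ℂ] EllTwo d} {x : ℝ} (hx : 0 ≤ x)
    (ha : wNorm B w (mat A) ≤ ENNReal.ofReal x) : ‖A‖ ≤ algConst d α c * x := by
  obtain ⟨A', h, h'⟩ := exists_operator_of_wNorm_le hα hc hw hx ha
  rwa [mat_injective h] at h'

end Algebra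

/-! ### The truncated homological equation. -/

open Classical in
/-- The solution `X` of `[r, X] = diag R - S_N R`, where `S_N` truncates to the diagonals with
`|k| ≤ N`. -/
def homMatrix (r : Lattice d → ℂ) (N : ℝ) (a : InfMatrix d) : InfMatrix d := fun i j =>
  if i = j ∨ N < ‖i - j‖ then 0 else -((r i - r j)⁻¹ * a i j)

open Classical in
/-- The part of a matrix on the diagonals with `|k| > N`. -/
def tailMatrix (N : ℝ) (a : InfMatrix d) : InfMatrix d := fun i j =>
  if ‖i - j‖ ≤ N then 0 else a i j

/-- The diagonal part of a matrix. -/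
def diagPart (a : InfMatrix d) : InfMatrix d := diagMatrix fun i => a i i

lemma kDiagonal_diagMatrix_zero (q : Lattice d → ℂ) : kDiagonal (diagMatrix q) 0 = q := by
  funext i
  simp [kDiagonal, diagMatrix]

lemma eq_sub_iff_eq_zero (i k : Lattice d) : i = i - k ↔ k = 0 := by
  rw [eq_comm, sub_eq_self]

lemma kDiagonal_diagMatrix {k : Lattice d} (hk : k ≠ 0) (q : Lattice d → ℂ) :
    kDiagonal (diagMatrix q) k = 0 := by
  funext i
  simp [kDiagonal, diagMatrix, eq_sub_iff_eq_zero, hk]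

lemma kDiagonal_zero (a : InfMatrix d) : kDiagonal a 0 = fun i => a i i := by
  funext i
  simp [kDiagonal]

section

variable {B : SequenceAlgebra d}

lemma wNorm_diagMatrix (w : Lattice d → ℝ) (q : Lattice d → ℂ) :
    wNorm B w (diagMatrix q) = B.extNorm q * ENNReal.ofReal (w 0) := by
  rw [wNorm, ellNorm, tsum_eq_single 0 fun k hk => by
    rw [kDiagonal_diagMatrix hk, B.extNorm_zero]; simp, kDiagonal_diagMatrix_zero, rpow_half_sq]

lemma extNorm_tailMatrix_of_le {N : ℝ} (a : InfMatrix d) {k : Lattice d} (hk : ‖k‖ ≤ N) :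
    B.extNorm (kDiagonal (tailMatrix N a) k) = 0 := by
  have : kDiagonal (tailMatrix N a) k = 0 := by
    funext i
    simp [kDiagonal, tailMatrix, hk]
  rw [this, B.extNorm_zero]

lemma extNorm_tailMatrix_of_lt {N : ℝ} (a : InfMatrix d) {k : Lattice d} (hk : N < ‖k‖) :
    B.extNorm (kDiagonal (tailMatrix N a) k) = B.extNorm (kDiagonal a k) := by
  congr 1
  funext i
  simp [kDiagonal, tailMatrix, hk.not_ge]

lemma wNorm_tailMatrix_le_mul (w w' : Lattice d → ℝ) (N : ℝ) (a : InfMatrix d) {c : ℝ} (hc : 0 ≤ c)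
    (h : ∀ k, N < ‖k‖ → w k ≤ c * w' k) :
    wNorm B w (tailMatrix N a) ≤ ENNReal.ofReal c * wNorm B w' a := by
  refine wNorm_le_mul B fun k => ?_
  rcases le_or_gt ‖k‖ N with hk | hk
  · rw [extNorm_tailMatrix_of_le a hk, zero_mul]
    exact zero_le
  · rw [extNorm_tailMatrix_of_lt a hk, mul_left_comm, ← ENNReal.ofReal_mul hc]
    gcongr
    exact h k hk

lemma wNorm_tailMatrix_le (w : Lattice d → ℝ) (N : ℝ) (a : InfMatrix d) :
    wNorm B w (tailMatrix N a) ≤ wNorm B w a := by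
  simpa using wNorm_tailMatrix_le_mul (B := B) w w N a zero_le_one fun k _ => (one_mul _).ge

lemma wNorm_diagPart_le (w : Lattice d → ℝ) (a : InfMatrix d) :
    wNorm B w (diagPart a) ≤ wNorm B w a := by
  rw [diagPart, wNorm_diagMatrix, ← kDiagonal_zero]
  exact extNorm_le_wNorm B w a 0

/-- Each diagonal is multiplied by the inverse differences, of norm at most `γ⁻¹ |k|^τ`. Leaving the
two weights free allows the loss `|k|^τ` to be paid either by the cutoff `N` or by a weaker weight.
-/
lemma wNorm_homMatrix_le {τ γ : ℝ} (hγ : 0 < γ) {r : Lattice d → ℂ} (hr : IsDistal B τ γ r)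
    (N : ℝ) (w w' : Lattice d → ℝ) (a : InfMatrix d) {c : ℝ} (hc : 0 ≤ c)
    (h : ∀ k, k ≠ 0 → ‖k‖ ≤ N → ‖k‖ ^ τ * w k ≤ c * w' k) :
    wNorm B w (homMatrix r N a) ≤ ENNReal.ofReal (γ⁻¹ * c) * wNorm B w' a := by
  refine wNorm_le_mul B fun k => ?_
  by_cases hk : k = 0 ∨ N < ‖k‖
  · have : kDiagonal (homMatrix r N a) k = 0 := by
      funext i
      simp only [kDiagonal, homMatrix, eq_sub_iff_eq_zero, sub_sub_cancel, if_pos hk]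
      rfl
    rw [this, B.extNorm_zero, zero_mul]
    exact zero_le
  · have e : kDiagonal (homMatrix r N a) k =
        -fun i => (r i - r (i - k))⁻¹ * kDiagonal a k i := by
      funext i
      simp only [kDiagonal, homMatrix, eq_sub_iff_eq_zero, sub_sub_cancel, if_neg hk]
      rfl
    push Not at hk
    have hkτ : 0 ≤ ‖k‖ ^ τ := Real.rpow_nonneg (norm_nonneg _) _
    rw [e, B.extNorm_neg]
    calc _ ≤ ENNReal.ofReal (γ⁻¹ * ‖k‖ ^ τ) * B.extNorm (kDiagonal a k) * ENNReal.ofReal (w k) := by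
          gcongr
          exact (B.extNorm_mul_le _ _).trans (mul_le_mul_left (hr.extNorm_inv_le hk.1) _)
      _ = B.extNorm (kDiagonal a k) * ENNReal.ofReal (γ⁻¹ * (‖k‖ ^ τ * w k)) := by
          rw [mul_right_comm, ← ENNReal.ofReal_mul (by positivity), mul_comm, mul_assoc γ⁻¹]
      _ ≤ B.extNorm (kDiagonal a k) * ENNReal.ofReal (γ⁻¹ * (c * w' k)) :=
          mul_le_mul_right (ENNReal.ofReal_le_ofReal
            (mul_le_mul_of_nonneg_left (h k hk.1 hk.2) (inv_nonneg.2 hγ.le))) _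
      _ = _ := by
          rw [← mul_assoc γ⁻¹, ENNReal.ofReal_mul (by positivity)]
          ring

end

lemma homMatrix_commutator {B : SequenceAlgebra d} {τ γ : ℝ} {r : Lattice d → ℂ}
    (hr : IsDistal B τ γ r) {N : ℝ} (hN : 0 ≤ N) (a : InfMatrix d) (i j : Lattice d) :
    (r i - r j) * homMatrix r N a i j = diagPart a i j - a i j + tailMatrix N a i j := by
  by_cases hij : i = j
  · subst hij
    simp [homMatrix, diagPart, diagMatrix, tailMatrix, hN]
  · rcases le_or_gt ‖i - j‖ N with h | h
    · have h0 : r i - r j ≠ 0 := by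
        have := (hr (i - j) (sub_ne_zero.2 hij)).1 i
        rwa [sub_sub_cancel] at this
      simp only [homMatrix, hij, h.not_gt, or_self, if_false, diagPart, diagMatrix, tailMatrix, h,
        if_true]
      rw [mul_neg, mul_inv_cancel_left₀ h0]
      ring
    · simp [homMatrix, diagPart, diagMatrix, tailMatrix, h, h.not_ge, hij]

lemma IsRealMatrix.homMatrix {r : Lattice d → ℂ} (hr : ∀ i, (r i).im = 0) (N : ℝ)
    {a : InfMatrix d} (ha : IsRealMatrix a) : IsRealMatrix (homMatrix r N a) := fun i j => by
  unfold PowerLaw.homMatrix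
  split_ifs
  · rfl
  · rw [Complex.neg_im, Complex.mul_im, ha, Complex.inv_im, Complex.sub_im, hr, hr]
    simp

lemma IsRealMatrix.tailMatrix (N : ℝ) {a : InfMatrix d} (ha : IsRealMatrix a) :
    IsRealMatrix (tailMatrix N a) := fun i j => by
  unfold PowerLaw.tailMatrix
  split_ifs
  · rfl
  · exact ha i j

lemma IsRealMatrix.diagPart {a : InfMatrix d} (ha : IsRealMatrix a) :
    IsRealMatrix (diagPart a) := fun i j => by
  unfold PowerLaw.diagPart diagMatrix
  split_ifs
  · exact ha i i
  · rfl

lemma mat_mul_of_diag {V Δ : EllTwo d →L[ℂ] EllTwo d} {a : InfMatrix d}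
    (hΔ : mat Δ = diagPart a) (i k : Lattice d) : mat (V * Δ) i k = mat V i k * a k k := by
  have h := hasSum_mat_comp V Δ i k
  refine h.unique ?_
  convert hasSum_single k fun j hj => ?_ using 1
  · rw [hΔ]; simp [diagPart, diagMatrix]
  · rw [hΔ]; simp [diagPart, diagMatrix, hj]

/-! ### One conjugation step. -/

/-- How an approximate conjugation improves in one step. -/
lemma conjugation_step {p r : Lattice d → ℂ} {T V R X Δ H R' : EllTwo d →L[ℂ] EllTwo d}
    (hV : ∀ i k, mat (T * V) i k + p i * mat V i k - mat V i k * r k = mat (V * R) i k)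
    (hΔ : mat Δ = diagPart (mat R))
    (hX : ∀ i j, (r i - r j) * mat X i j = mat Δ i j - mat R i j + mat H i j)
    (hR' : (1 + X) * R' = H + R * X - X * Δ) (i k : Lattice d) :
    mat (T * (V * (1 + X))) i k + p i * mat (V * (1 + X)) i k
      - mat (V * (1 + X)) i k * (r k + mat R k k) = mat (V * (1 + X) * R') i k := by
  have h1 := (hasSum_mat_comp V X i k).mul_left (p i)
  have h2 := ((hasSum_mat_comp V X i k).mul_right (r k)).add
    ((hasSum_mat_comp V (Δ - R + H) i k).add (hasSum_mat_comp (V * R - T * V) X i k))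
  -- The diagonal operators may be unbounded, so the identities are entrywise: `hV` moves `p`
  -- through `V` to become `r`, and `hX` moves `r` through `X`.
  have h3 : p i * mat (V * X) i k = mat (V * X) i k * r k +
      (mat (V * (Δ - R + H)) i k + mat ((V * R - T * V) * X) i k) := by
    refine h1.unique ?_
    convert h2 using 2 with j
    rw [mat_add, mat_sub, mat_sub, ← hV i j]
    linear_combination mat V i j * hX j k
  have h4 := mat_mul_of_diag (V := V * (1 + X)) hΔ i k
  have e1 : V * (1 + X) * R' = V * H + V * R * X - V * X * Δ := by
    rw [mul_assoc, hR']; noncomm_ring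
  have e2 : V * (1 + X) = V + V * X := by noncomm_ring
  have e3 : T * (V + V * X) = T * V + T * V * X := by noncomm_ring
  have e4 : V * (Δ - R + H) = V * Δ - V * R + V * H := by noncomm_ring
  have e5 : (V * R - T * V) * X = V * R * X - T * V * X := by noncomm_ring
  have e6 : (V + V * X) * Δ = V * Δ + V * X * Δ := by noncomm_ring
  have h5 := hV i k
  rw [e2, e6] at h4
  rw [e1, e2, e3]
  rw [e4, e5] at h3
  simp only [mat_add, mat_sub] at h3 h4 ⊢
  linear_combination h3 + h5 + h4

/-- The norms of the one-step construction. -/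
lemma exists_remainder {B : SequenceAlgebra d} {α c : ℝ} {w : Lattice d → ℝ}
    (hα : (d : ℝ) / 2 < α) (hc : 0 ≤ c) (hw : IsAlgWeight α c w)
    {R X Δ H : EllTwo d →L[ℂ] EllTwo d} {x ξ : ℝ} (hx : 0 ≤ x) (hξ : 0 ≤ ξ)
    (hR : wNorm B w (mat R) ≤ ENNReal.ofReal x) (hX : wNorm B w (mat X) ≤ ENNReal.ofReal ξ)
    (hΔ : wNorm B w (mat Δ) ≤ ENNReal.ofReal x) (hH : wNorm B w (mat H) ≤ ENNReal.ofReal x)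
    (hsmall : algConst d α c * ξ ≤ 1 / 2) :
    ∃ Z : EllTwo d →L[ℂ] EllTwo d, (1 + X) * (H + Z) = H + R * X - X * Δ ∧
      wNorm B w (mat Z) ≤ ENNReal.ofReal (6 * algConst d α c * (ξ * x)) ∧
      (IsRealMatrix (mat R) → IsRealMatrix (mat X) → IsRealMatrix (mat Δ) →
        IsRealMatrix (mat H) → IsRealMatrix (mat Z)) := by
  set M := algConst d α c with hM
  have hM1 : 1 ≤ M := one_le_algConst hc
  have hM0 : 0 ≤ M := zero_le_one.trans hM1
  -- Subtracting `(1 + X) H` from the prescribed right side leaves `Q`, so `Z = (1 + X)⁻¹ Q`. The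
  -- factor `6` is three products times the sum `2` of the Neumann series.
  set Q := R * X - X * Δ - X * H with hQ
  have hXn : ‖-X‖ < 1 := by
    rw [norm_neg]
    linarith [norm_le_of_wNorm_le hα hc hw.le hξ hX]
  have hQn : wNorm B w (mat Q) ≤ ENNReal.ofReal (3 * (M * (ξ * x))) := by
    have h1 := wNorm_mul_le_ofReal hα hc hw hx hR hX
    have h2 := wNorm_mul_le_ofReal hα hc hw hξ hX hΔ
    have h3 := wNorm_mul_le_ofReal hα hc hw hξ hX hH
    have e : mat Q = mat (R * X) - mat (X * Δ) - mat (X * H) := by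
      funext i j
      simp [hQ, mat_sub]
    rw [e]
    refine (wNorm_sub_le B w _ _).trans ((add_le_add (wNorm_sub_le B w _ _) le_rfl).trans ?_)
    refine (add_le_add (add_le_add h1 h2) h3).trans (le_of_eq ?_)
    rw [← ENNReal.ofReal_add (by positivity) (by positivity),
      ← ENNReal.ofReal_add (by positivity) (by positivity)]
    congr 1
    ring
  have hs : HasSum (fun n => (-X) ^ n) (∑' n, (-X) ^ n) :=
    (summable_geometric_of_norm_lt_one hXn).hasSum
  have hterm : ∀ n : ℕ, wNorm B w (mat ((-X) ^ n * Q)) ≤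
      ENNReal.ofReal ((1 / 2) ^ n * (3 * (M * (ξ * x)))) := fun n => by
    induction n with
    | zero => simpa using hQn
    | succ n ih =>
      have hX' : wNorm B w (mat (-X)) ≤ ENNReal.ofReal ξ := by
        have e : mat (-X) = -mat X := by
          funext i j
          rw [mat_neg]; rfl
        rwa [e, wNorm_neg]
      rw [pow_succ', mul_assoc]
      refine (wNorm_mul_le_ofReal hα hc hw hξ hX' ih).trans (ENNReal.ofReal_le_ofReal ?_)
      have h0 : 0 ≤ (1 / 2 : ℝ) ^ n * (3 * (M * (ξ * x))) := by positivity
      calc M * (ξ * ((1 / 2 : ℝ) ^ n * (3 * (M * (ξ * x)))))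
          = (M * ξ) * ((1 / 2 : ℝ) ^ n * (3 * (M * (ξ * x)))) := by ring
        _ ≤ 1 / 2 * ((1 / 2 : ℝ) ^ n * (3 * (M * (ξ * x)))) := by gcongr
        _ = _ := by ring
  refine ⟨(∑' n, (-X) ^ n) * Q, ?_, ?_, fun hR hX hΔ hH => ?_⟩
  · have h1 := mul_neg_geom_series (-X) hXn
    rw [sub_neg_eq_add] at h1
    rw [mul_add, ← mul_assoc, h1, one_mul, hQ]
    noncomm_ring
  · refine (wNorm_le_tsum B w (hasSum_mat (hs.mul_right Q))).trans
      ((ENNReal.tsum_le_tsum hterm).trans (le_of_eq ?_))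
    have hg : HasSum (fun n : ℕ => (1 / 2 : ℝ) ^ n * (3 * (M * (ξ * x))))
        (2 * (3 * (M * (ξ * x)))) :=
      hasSum_geometric_two.mul_right _
    rw [← ENNReal.ofReal_tsum_of_nonneg (fun n => by positivity) hg.summable, hg.tsum_eq]
    congr 1
    ring
  · have hQr : IsRealMatrix (mat Q) := ((hR.mul hX).sub (hX.mul hΔ)).sub (hX.mul hH)
    exact isRealMatrix_of_hasSum (hs.mul_right Q) fun n => (hX.neg.pow n).mul hQr

/-! ### The multiscale iteration. -/

/-- The weight at scale `2^n`, which interpolates between the exponents `α` and `a`. -/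
def scaleWeight (α a : ℝ) (n : ℕ) (k : Lattice d) : ℝ :=
  powWeight α k + ((2 : ℝ) ^ n) ^ (-(a - α)) * powWeight a k

/-- The constants of the iteration and their smallness assumptions. -/
structure IterationData (d : ℕ) (τ γ α a : ℝ) where
  δ : ℝ
  K : ℝ
  A : ℝ
  ρ : ℝ
  ε : ℝ
  η : ℝ
  hδ : 0 < δ
  hα : (d : ℝ) / 2 < α
  hτ : 0 < τ
  hγ : 0 < γ
  ha : α + τ + 11 * δ < a
  -- At the next scale the tail contributes `4ε` and the quadratic part `ε`, times `N^{-(a-α)}`;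
  -- `2^{a-α}` pays for passing from `N` to `2N`. The constant `A` is the factor `6` of
  -- `exists_remainder`, the algebra constant, one small divisor and two factors `K`.
  hK : K = 5 * 2 ^ (a - α)
  hA : A = 6 * algConst d α (2 ^ a) * γ⁻¹ * K ^ 2
  hρ : ρ = 2 ^ (-(11 * δ))
  hε : 0 ≤ ε
  h_small : A * ε ≤ 1 - ρ
  h_half : algConst d α (2 ^ a) * (γ⁻¹ * K * ε) ≤ 1 / 2
  -- Keeps the accumulated corrections `q` within `η`, where distality is available.
  h_eta : A / ρ * ε ^ 2 ≤ η * (1 - ρ)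
  -- After summing the geometric series, this gives `‖V - 1‖ ≤ 1/4` in the limit.
  h_quarter : algConst d α (2 ^ a) * (2 * γ⁻¹ * K * ε) ≤ (1 - ρ) / 4

/-- The state of the iteration at scale `2^n`: with `D = diag p`, the operator `V` conjugates
`T + D` to `D + diag q + R`. -/
structure IsApprox {τ γ α a : ℝ} (I : IterationData d τ γ α a) (B : SequenceAlgebra d)
    (p : Lattice d → ℂ) (T : EllTwo d →L[ℂ] EllTwo d) (n : ℕ)
    (q : Lattice d → ℂ) (R V : EllTwo d →L[ℂ] EllTwo d) : Prop where
  q_le : B.extNorm q ≤ ENNReal.ofReal (I.A / I.ρ * I.ε ^ 2 * ∑ j ∈ Finset.range n, I.ρ ^ j)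
  diag_le : B.extNorm (fun i => mat R i i) ≤ ENNReal.ofReal (I.A / I.ρ * I.ε ^ 2 * I.ρ ^ n)
  high_le : wNorm B (powWeight a) (mat R) ≤
    ENNReal.ofReal (I.ε + I.A * I.ε ^ 2 * ∑ j ∈ Finset.range n, I.ρ ^ j)
  low_le : wNorm B (scaleWeight α a n) (mat R) ≤
    ENNReal.ofReal (I.K * I.ε * ((2 : ℝ) ^ n) ^ (-(a - α)))
  V_le : wNorm B (powWeight (a - τ - 11 * I.δ)) (mat (V - 1)) ≤
    ENNReal.ofReal (2 * γ⁻¹ * I.K * I.ε * ∑ j ∈ Finset.range n, I.ρ ^ j)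
  conj : ∀ i k, mat (T * V) i k + p i * mat V i k - mat V i k * (q + p) k = mat (V * R) i k
  real : (∀ i, (p i).im = 0) → IsRealMatrix (mat T) → (∀ i, (q i).im = 0) ∧ IsRealMatrix (mat R)

namespace IterationData

variable {τ γ α a : ℝ} (I : IterationData d τ γ α a)

include I

lemma α_pos : 0 ≤ α := (by positivity : (0 : ℝ) ≤ (d : ℝ) / 2).trans I.hα.le

lemma α_le : α ≤ a := by linarith [I.ha, I.hτ, I.hδ]

lemma α_le_target : α ≤ a - τ - 11 * I.δ := by linarith [I.ha]

lemma target_le : a - τ - 11 * I.δ ≤ a := by linarith [I.hτ, I.hδ]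

lemma K_pos : 0 < I.K := by rw [I.hK]; positivity

lemma A_pos : 0 < I.A := by
  have h1 := I.K_pos
  have h2 := I.hγ
  have h3 : 1 ≤ algConst d α (2 ^ a) := one_le_algConst (by positivity)
  rw [I.hA]
  positivity

lemma ρ_pos : 0 < I.ρ := by rw [I.hρ]; positivity

lemma ρ_lt_one : I.ρ < 1 := by
  rw [I.hρ]
  exact Real.rpow_lt_one_of_one_lt_of_neg (by norm_num) (by linarith [I.hδ])

lemma sum_nonneg (n : ℕ) : 0 ≤ ∑ j ∈ Finset.range n, I.ρ ^ j :=
  Finset.sum_nonneg fun j _ => pow_nonneg I.ρ_pos.le j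

lemma sum_le (n : ℕ) : (1 - I.ρ) * ∑ j ∈ Finset.range n, I.ρ ^ j ≤ 1 := by
  rw [mul_neg_geom_sum]
  linarith [pow_nonneg I.ρ_pos.le n]

lemma ρ_pow (n : ℕ) : I.ρ ^ n = ((2 : ℝ) ^ n) ^ (-(11 * I.δ)) := by
  rw [I.hρ, ← Real.rpow_natCast, ← Real.rpow_natCast, ← Real.rpow_mul (by norm_num),
    ← Real.rpow_mul (by norm_num), mul_comm]

lemma isAlgWeight_scaleWeight (n : ℕ) :
    IsAlgWeight α (2 ^ a) (scaleWeight α a n : Lattice d → ℝ) :=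
  isAlgWeight_add I.α_pos I.α_le (by positivity)

lemma isAlgWeight_target :
    IsAlgWeight α (2 ^ a) (powWeight (a - τ - 11 * I.δ) : Lattice d → ℝ) :=
  isAlgWeight_powWeight I.α_pos I.α_le_target I.target_le

end IterationData

namespace IsApprox

variable {τ γ α a : ℝ} {I : IterationData d τ γ α a} {B : SequenceAlgebra d}
  {p : Lattice d → ℂ} {T : EllTwo d →L[ℂ] EllTwo d} {n : ℕ}
  {q : Lattice d → ℂ} {R V : EllTwo d →L[ℂ] EllTwo d}

lemma zero (hT : wNorm B (powWeight a) (mat T) ≤ ENNReal.ofReal I.ε) (hdiag : ∀ i, mat T i i = 0) :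
    IsApprox I B p T 0 0 T 1 where
  q_le := by simp [B.extNorm_zero]
  diag_le := by
    have : (fun i => mat T i i) = 0 := funext hdiag
    rw [this, B.extNorm_zero]
    exact zero_le
  high_le := by simpa using hT
  low_le := by
    have h1 : wNorm B (scaleWeight α a 0) (mat T) ≤
        ENNReal.ofReal 2 * wNorm B (powWeight a) (mat T) := by
      refine wNorm_le_mul B fun k => ?_
      rw [mul_left_comm, ← ENNReal.ofReal_mul (by norm_num)]
      gcongr
      rw [scaleWeight, pow_zero, Real.one_rpow]
      linarith [powWeight_mono I.α_le k]
    refine h1.trans ?_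
    rw [pow_zero, Real.one_rpow, mul_one, ENNReal.ofReal_mul I.K_pos.le]
    refine mul_le_mul' (ENNReal.ofReal_le_ofReal ?_) hT
    have : (1 : ℝ) ≤ 2 ^ (a - α) := Real.one_le_rpow (by norm_num) (by linarith [I.α_le])
    rw [I.hK]
    linarith
  V_le := by
    have : wNorm B (powWeight (a - τ - 11 * I.δ)) (mat (1 - 1 : EllTwo d →L[ℂ] EllTwo d)) = 0 := by
      have e : ∀ k, kDiagonal (mat (1 - 1 : EllTwo d →L[ℂ] EllTwo d)) k = 0 := fun k => by
        funext i
        simp [kDiagonal, mat]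
      simp only [wNorm, ellNorm, e, B.extNorm_zero]
      simp
    rw [this]
    exact zero_le
  conj i k := by
    rw [mul_one, one_mul, mat_one]
    by_cases h : i = k
    · subst h; simp
    · simp [h]
  real _ hT := ⟨fun _ => rfl, hT⟩

-- The induction step: cut at `N = 2^n`, conjugate by `1 + X`, and move the diagonal of `R` into
-- `q`. The increments of `q` and `V` are returned as well, since the limit is taken by telescoping.
set_option maxHeartbeats 1000000 in
lemma step (hdist : ∀ q : Lattice d → ℂ, B.extNorm q ≤ ENNReal.ofReal I.η → IsDistal B τ γ (q + p))
    (h : IsApprox I B p T n q R V) :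
    ∃ q' R' V', IsApprox I B p T (n + 1) q' R' V' ∧
      B.extNorm (q' - q) ≤ ENNReal.ofReal (I.A / I.ρ * I.ε ^ 2 * I.ρ ^ n) ∧
      wNorm B (powWeight (a - τ - 11 * I.δ)) (mat (V' - V)) ≤
        ENNReal.ofReal (2 * γ⁻¹ * I.K * I.ε * I.ρ ^ n) := by
  have hc : (0 : ℝ) ≤ 2 ^ a := by positivity
  have hK := I.K_pos
  have hA := I.A_pos
  have hρ := I.ρ_pos
  have hρ1 := I.ρ_lt_one
  have hε := I.hε
  have hM1 : 1 ≤ algConst d α (2 ^ a) := one_le_algConst hc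
  have hG : 0 < γ⁻¹ := inv_pos.2 I.hγ
  set M := algConst d α (2 ^ a) with hM
  have hM0 : 0 < M := by linarith
  set S := ∑ j ∈ Finset.range n, I.ρ ^ j with hS
  have hS0 : 0 ≤ S := I.sum_nonneg n
  have hS1 : (1 - I.ρ) * S ≤ 1 := I.sum_le n
  set N : ℝ := 2 ^ n with hN
  have hN1 : 1 ≤ N := one_le_pow₀ (by norm_num)
  have hN0 : 0 < N := by linarith
  set t := N ^ (-(a - α)) with ht
  have ht0 : 0 < t := Real.rpow_pos_of_pos hN0 _
  have ht1 : t ≤ 1 := Real.rpow_le_one_of_one_le_of_nonpos hN1 (by linarith [I.α_le])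
  have ht' : ((2 : ℝ) ^ (n + 1)) ^ (-(a - α)) = 2 ^ (-(a - α)) * t := by
    rw [pow_succ', Real.mul_rpow (by norm_num) hN0.le]
  have hρn := I.ρ_pow n
  have hρn0 : 0 < I.ρ ^ n := pow_pos hρ n
  have hρn1 : I.ρ ^ n ≤ 1 := pow_le_one₀ hρ.le hρ1.le
  have hNτ : 0 < N ^ τ := Real.rpow_pos_of_pos hN0 _
  -- The gap `a - α - τ > 11δ` absorbs the small-divisor loss.
  have hNt : N ^ τ * t ≤ I.ρ ^ n := by
    rw [ht, ← Real.rpow_add hN0, hρn]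
    exact Real.rpow_le_rpow_of_exponent_le hN1 (by linarith [I.ha])
  have hq : IsDistal B τ γ (q + p) := hdist q (h.q_le.trans (ENNReal.ofReal_le_ofReal (by
    have h1 := mul_le_mul_of_nonneg_right I.h_eta hS0
    have h2 : I.η * (1 - I.ρ) * S ≤ I.η := by
      have : 0 ≤ I.η := by
        refine nonneg_of_mul_nonneg_left (le_trans ?_ I.h_eta) (by linarith : 0 < 1 - I.ρ)
        positivity
      nlinarith
    linarith)))
  -- the operators of the step
  have hw := I.isAlgWeight_scaleWeight n
  set x := I.K * I.ε * t with hx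
  have hx0 : 0 ≤ x := by positivity
  set ξ := γ⁻¹ * N ^ τ * x with hξ
  have hξ0 : 0 ≤ ξ := by positivity
  have hξle : ξ ≤ γ⁻¹ * I.K * I.ε * I.ρ ^ n := by
    calc ξ = γ⁻¹ * I.K * I.ε * (N ^ τ * t) := by rw [hξ, hx]; ring
      _ ≤ _ := by gcongr
  have hMξ : M * ξ ≤ 1 / 2 := by
    refine le_trans ?_ I.h_half
    refine mul_le_mul_of_nonneg_left (hξle.trans ?_) hM0.le
    exact mul_le_of_le_one_right (by positivity) hρn1
  have hXw : wNorm B (scaleWeight α a n) (homMatrix (q + p) N (mat R)) ≤ ENNReal.ofReal ξ := by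
    refine (wNorm_homMatrix_le I.hγ hq N _ (scaleWeight α a n) (mat R) hNτ.le
      fun k _ hk => ?_).trans ?_
    · exact mul_le_mul_of_nonneg_right (Real.rpow_le_rpow (norm_nonneg _) hk I.hτ.le)
        ((powWeight_pos α k).le.trans (hw.le k))
    · rw [hξ, ENNReal.ofReal_mul (by positivity : 0 ≤ γ⁻¹ * N ^ τ)]
      exact mul_le_mul_right h.low_le _
  -- Here the loss is paid by the weight: for `|k| ≤ N`, `|k|^τ |k|^{a-τ-11δ} ≤ N^{a-11δ-α} |k|^α`,
  -- and multiplying by `N^{-(a-α)}` leaves exactly `N^{-11δ} = ρ^n`.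
  have hXb : wNorm B (powWeight (a - τ - 11 * I.δ)) (homMatrix (q + p) N (mat R)) ≤
      ENNReal.ofReal (γ⁻¹ * I.K * I.ε * I.ρ ^ n) := by
    have hcp : 0 < N ^ (a - 11 * I.δ - α) := Real.rpow_pos_of_pos hN0 _
    refine (wNorm_homMatrix_le I.hγ hq N _ (scaleWeight α a n) (mat R) hcp.le
      fun k hk0 hk => ?_).trans ?_
    · have hk1 : 0 < ‖k‖ := zero_lt_one.trans_le (one_le_norm hk0)
      refine le_trans ?_ (mul_le_mul_of_nonneg_left (hw.le k) hcp.le)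
      rw [powWeight, powWeight, bracket_eq_norm hk0, ← Real.rpow_add hk1]
      have e : τ + (a - τ - 11 * I.δ) = (a - 11 * I.δ - α) + α := by ring
      rw [e, Real.rpow_add hk1]
      refine mul_le_mul_of_nonneg_right ?_ (by positivity)
      exact Real.rpow_le_rpow hk1.le hk (by linarith [I.ha, I.hτ])
    · have e : γ⁻¹ * I.K * I.ε * I.ρ ^ n = γ⁻¹ * N ^ (a - 11 * I.δ - α) * x := by
        have : I.ρ ^ n = N ^ (a - 11 * I.δ - α) * t := by
          rw [ht, ← Real.rpow_add hN0, hρn]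
          congr 1
          ring
        rw [this, hx]
        ring
      rw [e, ENNReal.ofReal_mul (by positivity : 0 ≤ γ⁻¹ * N ^ (a - 11 * I.δ - α))]
      exact mul_le_mul_right h.low_le _
  obtain ⟨X, hX, -⟩ := exists_operator_of_wNorm_le I.hα hc hw.le hξ0 hXw
  obtain ⟨Δ, hΔ, -⟩ := exists_operator_of_wNorm_le I.hα hc hw.le hx0
    ((wNorm_diagPart_le _ _).trans h.low_le)
  obtain ⟨H, hH, -⟩ := exists_operator_of_wNorm_le I.hα hc hw.le hx0
    ((wNorm_tailMatrix_le _ N _).trans h.low_le)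
  obtain ⟨Z, hZ, hZn, hZr⟩ := exists_remainder I.hα hc hw hx0 hξ0 h.low_le (hX ▸ hXw)
    (hΔ ▸ (wNorm_diagPart_le _ _).trans h.low_le)
    (hH ▸ (wNorm_tailMatrix_le _ N _).trans h.low_le) hMξ
  rw [← hM] at hZn
  have hZn' : wNorm B (scaleWeight α a n) (mat Z) ≤
      ENNReal.ofReal (I.A * I.ε ^ 2 * I.ρ ^ n * t) := by
    refine hZn.trans (ENNReal.ofReal_le_ofReal ?_)
    calc 6 * M * (ξ * x) = I.A * I.ε ^ 2 * (N ^ τ * t) * t := by rw [hξ, hx, I.hA]; ring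
      _ ≤ _ := by gcongr
  -- The scale weight dominates `t ⟨k⟩^a`, so the factor `t` in `hZn'` cancels and the high norm
  -- grows by a summable amount only.
  have hZhigh : wNorm B (powWeight a) (mat Z) ≤ ENNReal.ofReal (I.A * I.ε ^ 2 * I.ρ ^ n) := by
    have h1 : wNorm B (powWeight a) (mat Z) ≤
        ENNReal.ofReal t⁻¹ * wNorm B (scaleWeight α a n) (mat Z) := by
      refine wNorm_le_mul B fun k => ?_
      rw [mul_left_comm, ← ENNReal.ofReal_mul (by positivity)]
      refine mul_le_mul_right (ENNReal.ofReal_le_ofReal ?_) _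
      rw [scaleWeight, mul_add, inv_mul_cancel_left₀ ht0.ne']
      exact le_add_of_nonneg_left (mul_nonneg (by positivity) (powWeight_pos α k).le)
    refine (h1.trans (mul_le_mul_right hZn' _)).trans (le_of_eq ?_)
    rw [← ENNReal.ofReal_mul (by positivity)]
    congr 1
    field_simp
  have hZdiag : B.extNorm (fun i => mat Z i i) ≤ ENNReal.ofReal (I.A * I.ε ^ 2 * I.ρ ^ n * t) := by
    refine le_trans ?_ hZn'
    refine le_trans ?_ (extNorm_le_wNorm B _ _ 0)
    rw [kDiagonal_zero]
    refine le_mul_of_one_le_right' (ENNReal.one_le_ofReal.2 ?_)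
    exact (one_le_powWeight I.α_pos 0).trans (hw.le 0)
  have hAε : I.A * I.ε ≤ 1 := by linarith [I.h_small]
  have hhigh2 : I.ε + I.A * I.ε ^ 2 * S ≤ 2 * I.ε := by
    have : I.A * I.ε * S ≤ 1 := (mul_le_mul_of_nonneg_right I.h_small hS0).trans hS1
    nlinarith
  have hmatadd : ∀ A A' : EllTwo d →L[ℂ] EllTwo d, mat (A + A') = mat A + mat A' := fun A A' => by
    funext i j
    exact mat_add A A' i j
  have hVX : wNorm B (powWeight (a - τ - 11 * I.δ)) (mat (V * (1 + X) - V)) ≤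
      ENNReal.ofReal (2 * γ⁻¹ * I.K * I.ε * I.ρ ^ n) := by
    have e : V * (1 + X) - V = X + (V - 1) * X := by noncomm_ring
    have hy0 : 0 ≤ γ⁻¹ * I.K * I.ε * I.ρ ^ n := by positivity
    have hv0 : 0 ≤ 2 * γ⁻¹ * I.K * I.ε * S := by positivity
    have hX' := hXb
    rw [← hX] at hX'
    have h1 := wNorm_mul_le_ofReal I.hα hc I.isAlgWeight_target hv0 h.V_le hX'
    rw [e, hmatadd]
    refine ((wNorm_add_le B _ _ _).trans (add_le_add hX' h1)).trans ?_
    rw [← ENNReal.ofReal_add hy0 (by positivity)]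
    refine ENNReal.ofReal_le_ofReal ?_
    have h2 : M * (2 * γ⁻¹ * I.K * I.ε * S) ≤ 1 := by
      have := mul_le_mul_of_nonneg_right I.h_quarter hS0
      nlinarith
    nlinarith [mul_le_mul_of_nonneg_right h2 hy0]
  refine ⟨q + fun i => mat R i i, H + Z, V * (1 + X), ⟨?_, ?_, ?_, ?_, ?_, ?_, ?_⟩, ?_, hVX⟩
  · refine ((B.extNorm_add_le _ _).trans (add_le_add h.q_le h.diag_le)).trans (le_of_eq ?_)
    rw [← ENNReal.ofReal_add (by positivity) (by positivity), Finset.sum_range_succ, mul_add]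
  -- The tail has no main diagonal, so the new diagonal is purely quadratic; the `1/ρ` in `diag_le`
  -- accounts for the shift from `ρ^n` to `ρ^(n+1)`.
  · have e : (fun i => mat (H + Z) i i) = fun i => mat Z i i := by
      funext i
      simp [mat_add, hH, tailMatrix, hN0.le]
    rw [e]
    refine hZdiag.trans (ENNReal.ofReal_le_ofReal ?_)
    calc I.A * I.ε ^ 2 * I.ρ ^ n * t ≤ I.A * I.ε ^ 2 * I.ρ ^ n * 1 := by gcongr
      _ = I.A / I.ρ * I.ε ^ 2 * I.ρ ^ (n + 1) := by
          field_simp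
          ring
  · rw [hmatadd]
    refine (wNorm_add_le B _ _ _).trans ((add_le_add
      ((hH ▸ (wNorm_tailMatrix_le _ N _).trans h.high_le)) hZhigh).trans (le_of_eq ?_))
    rw [← ENNReal.ofReal_add (by positivity) (by positivity), Finset.sum_range_succ]
    congr 1
    ring
  · have h2β : (0 : ℝ) < 2 ^ (-(a - α)) := by positivity
    have h2β1 : (2 : ℝ) ^ (-(a - α)) ≤ 1 :=
      Real.rpow_le_one_of_one_le_of_nonpos (by norm_num) (by linarith [I.α_le])
    -- Beyond `N` one has `⟨k⟩^α ≤ N^{-(a-α)} ⟨k⟩^a`, so the tail is bounded through the high norm,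
    -- itself at most `2ε`.
    have hH' : wNorm B (scaleWeight α a (n + 1)) (mat H) ≤ ENNReal.ofReal (2 * t * (2 * I.ε)) := by
      rw [hH]
      refine (wNorm_tailMatrix_le_mul _ (powWeight a) N _ (by positivity : 0 ≤ 2 * t)
        fun k hk => ?_).trans ?_
      · have hk1 : N ≤ bracket k := hk.le.trans (norm_le_bracket k)
        have h1 : powWeight α k ≤ t * powWeight a k := by
          have e : powWeight α k = bracket k ^ (-(a - α)) * powWeight a k := by
            rw [powWeight, powWeight, ← Real.rpow_add (bracket_pos k)]
            congr 1
            ring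
          rw [e]
          exact mul_le_mul_of_nonneg_right (Real.rpow_le_rpow_of_nonpos hN0 hk1
            (by linarith [I.α_le])) (powWeight_pos a k).le
        have h2 : (2 : ℝ) ^ (-(a - α)) * t * powWeight a k ≤ t * powWeight a k :=
          mul_le_mul_of_nonneg_right (mul_le_of_le_one_left ht0.le h2β1) (powWeight_pos a k).le
        rw [scaleWeight, ht']
        linarith
      · rw [ENNReal.ofReal_mul (by positivity : 0 ≤ 2 * t)]
        exact mul_le_mul_right (h.high_le.trans (ENNReal.ofReal_le_ofReal hhigh2)) _
    have hZ' : wNorm B (scaleWeight α a (n + 1)) (mat Z) ≤ ENNReal.ofReal (I.ε * t) := by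
      have h1 : wNorm B (scaleWeight α a (n + 1)) (mat Z) ≤
          1 * wNorm B (scaleWeight α a n) (mat Z) := by
        refine wNorm_le_mul B fun k => ?_
        rw [one_mul]
        refine mul_le_mul_right (ENNReal.ofReal_le_ofReal ?_) _
        rw [scaleWeight, scaleWeight, ht']
        have := mul_le_mul_of_nonneg_right (mul_le_of_le_one_left ht0.le h2β1)
          (powWeight_pos a k).le
        linarith
      rw [one_mul] at h1
      refine (h1.trans hZn').trans (ENNReal.ofReal_le_ofReal ?_)
      refine mul_le_mul_of_nonneg_right ?_ ht0.le
      calc I.A * I.ε ^ 2 * I.ρ ^ n = (I.A * I.ε) * I.ρ ^ n * I.ε := by ring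
        _ ≤ 1 * 1 * I.ε := by gcongr
        _ = I.ε := by ring
    rw [hmatadd]
    refine (wNorm_add_le B _ _ _).trans ((add_le_add hH' hZ').trans (le_of_eq ?_))
    rw [← ENNReal.ofReal_add (by positivity) (by positivity), ht', I.hK]
    congr 1
    rw [Real.rpow_neg (by norm_num)]
    field_simp
    ring
  · have e : V * (1 + X) - 1 = (V - 1) + (V * (1 + X) - V) := by abel
    rw [e, hmatadd]
    refine (wNorm_add_le B _ _ _).trans ((add_le_add h.V_le hVX).trans (le_of_eq ?_))
    rw [← ENNReal.ofReal_add (by positivity) (by positivity), Finset.sum_range_succ, mul_add]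
  · intro i k
    have := conjugation_step (r := q + p) (R' := H + Z) h.conj hΔ (fun i j => by
      rw [hX, hΔ, hH]; exact homMatrix_commutator hq hN0.le (mat R) i j) hZ i k
    rw [← this]
    simp only [Pi.add_apply]
    ring
  · intro hp hT
    obtain ⟨hqr, hRr⟩ := h.real hp hT
    have hqp : ∀ i, ((q + p) i).im = 0 := fun i => by
      rw [Pi.add_apply, Complex.add_im, hqr, hp, add_zero]
    have hXr : IsRealMatrix (mat X) := hX ▸ hRr.homMatrix hqp N
    have hΔr : IsRealMatrix (mat Δ) := hΔ ▸ hRr.diagPart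
    have hHr : IsRealMatrix (mat H) := hH ▸ hRr.tailMatrix N
    refine ⟨fun i => ?_, hHr.add (hZr hRr hXr hΔr hHr)⟩
    rw [Pi.add_apply, Complex.add_im, hqr, hRr i i, add_zero]
  · rw [add_sub_cancel_left]
    exact h.diag_le

end IsApprox

/-! ### Passage to the limit. -/

/-- The increments of `q` and `V` are dominated by `ρ^n` and the low norm of `R` tends to zero, so
the remainder disappears from the conjugation identity. -/
lemma exists_limit_of_isApprox {τ γ α a : ℝ} (I : IterationData d τ γ α a) {B : SequenceAlgebra d}
    {p : Lattice d → ℂ} {T : EllTwo d →L[ℂ] EllTwo d}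
    (hdist : ∀ q : Lattice d → ℂ, B.extNorm q ≤ ENNReal.ofReal I.η → IsDistal B τ γ (q + p))
    (hT : wNorm B (powWeight a) (mat T) ≤ ENNReal.ofReal I.ε) (hdiag : ∀ i, mat T i i = 0) :
    ∃ (q : Lattice d → ℂ) (V : EllTwo d →L[ℂ] EllTwo d),
      B.extNorm q ≤ ENNReal.ofReal (I.A / I.ρ * I.ε ^ 2 * (1 - I.ρ)⁻¹) ∧
      wNorm B (powWeight (a - τ - 11 * I.δ)) (mat (V - 1)) ≤ ENNReal.ofReal (1 / 4) ∧
      ‖V - 1‖ ≤ 1 / 4 ∧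
      (∀ i k, mat (T * V) i k + p i * mat V i k - mat V i k * (q + p) k = 0) ∧
      ((∀ i, (p i).im = 0) → IsRealMatrix (mat T) → ∀ i, (q i).im = 0) := by
  have hρ := I.ρ_pos
  have hρ1 := I.ρ_lt_one
  have hK := I.K_pos
  have hA := I.A_pos
  have hε := I.hε
  have hG : 0 < γ⁻¹ := inv_pos.2 I.hγ
  have hc2 : (0 : ℝ) ≤ 2 ^ a := by positivity
  have hM1 : 1 ≤ algConst d α (2 ^ a) := one_le_algConst hc2
  have hgeo : HasSum (fun n : ℕ => I.ρ ^ n) (1 - I.ρ)⁻¹ := hasSum_geometric_of_lt_one hρ.le hρ1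
  have hstep : ∀ (n : ℕ) (s : (Lattice d → ℂ) × (EllTwo d →L[ℂ] EllTwo d) ×
      (EllTwo d →L[ℂ] EllTwo d)), IsApprox I B p T n s.1 s.2.1 s.2.2 →
      ∃ s' : (Lattice d → ℂ) × (EllTwo d →L[ℂ] EllTwo d) × (EllTwo d →L[ℂ] EllTwo d),
        IsApprox I B p T (n + 1) s'.1 s'.2.1 s'.2.2 ∧
        B.extNorm (s'.1 - s.1) ≤ ENNReal.ofReal (I.A / I.ρ * I.ε ^ 2 * I.ρ ^ n) ∧
        wNorm B (powWeight (a - τ - 11 * I.δ)) (mat (s'.2.2 - s.2.2)) ≤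
          ENNReal.ofReal (2 * γ⁻¹ * I.K * I.ε * I.ρ ^ n) := fun n s hs => by
    obtain ⟨q', R', V', h1, h2, h3⟩ := hs.step hdist
    exact ⟨(q', R', V'), h1, h2, h3⟩
  choose! f hf hfq hfV using hstep
  let S : ℕ → (Lattice d → ℂ) × (EllTwo d →L[ℂ] EllTwo d) × (EllTwo d →L[ℂ] EllTwo d) :=
    fun n => Nat.rec (0, T, 1) f n
  have hS : ∀ n, IsApprox I B p T n (S n).1 (S n).2.1 (S n).2.2 := fun n => by
    induction n with
    | zero => exact IsApprox.zero hT hdiag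
    | succ n ih => exact hf n (S n) ih
  set Q := fun n => (S n).1 with hQ
  set R := fun n => (S n).2.1 with hR
  set V := fun n => (S n).2.2 with hV
  have hQd : ∀ n, B.extNorm (Q (n + 1) - Q n) ≤
      ENNReal.ofReal (I.A / I.ρ * I.ε ^ 2 * I.ρ ^ n) := fun n => hfq n (S n) (hS n)
  have hVd : ∀ n, wNorm B (powWeight (a - τ - 11 * I.δ)) (mat (V (n + 1) - V n)) ≤
      ENNReal.ofReal (2 * γ⁻¹ * I.K * I.ε * I.ρ ^ n) := fun n => hfV n (S n) (hS n)
  have hQs : ∀ i, Summable fun n => Q (n + 1) i - Q n i := fun i =>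
    .of_norm_bounded (hgeo.summable.mul_left (I.A / I.ρ * I.ε ^ 2)) fun n =>
      B.norm_le_of_extNorm_le (by positivity) (hQd n) i
  have hVs : Summable fun n => V (n + 1) - V n :=
    .of_norm_bounded (hgeo.summable.mul_left (algConst d α (2 ^ a) * (2 * γ⁻¹ * I.K * I.ε)))
      fun n => (norm_le_of_wNorm_le I.hα hc2 I.isAlgWeight_target.le (by positivity)
        (hVd n)).trans_eq (by ring)
  set q : Lattice d → ℂ := fun i => ∑' n, (Q (n + 1) i - Q n i) with hq
  set U := ∑' n, (V (n + 1) - V n) with hU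
  have hQlim : ∀ i, Filter.Tendsto (fun n => Q n i) Filter.atTop (nhds (q i)) := fun i => by
    have := (hQs i).hasSum.tendsto_sum_nat
    simp only [Finset.sum_range_sub fun n => Q n i] at this
    have h0 : Q 0 i = 0 := rfl
    simpa only [h0, sub_zero] using this
  have hVlim : Filter.Tendsto V Filter.atTop (nhds (1 + U)) := by
    have := hVs.hasSum.tendsto_sum_nat
    simp only [Finset.sum_range_sub V] at this
    have h0 : V 0 = 1 := rfl
    rw [h0] at this
    simpa using this.const_add 1
  have hRlim : Filter.Tendsto R Filter.atTop (nhds 0) := by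
    rw [tendsto_zero_iff_norm_tendsto_zero]
    have hb : ∀ n, ‖R n‖ ≤ algConst d α (2 ^ a) * (I.K * I.ε) * ((2 : ℝ) ^ (-(a - α))) ^ n :=
      fun n => by
        refine (norm_le_of_wNorm_le I.hα hc2 (I.isAlgWeight_scaleWeight n).le (by positivity)
          (hS n).low_le).trans_eq ?_
        have : ((2 : ℝ) ^ n) ^ (-(a - α)) = ((2 : ℝ) ^ (-(a - α))) ^ n := by
          rw [← Real.rpow_natCast, ← Real.rpow_natCast, ← Real.rpow_mul (by norm_num),
            ← Real.rpow_mul (by norm_num), mul_comm]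
        rw [this]
        ring
    refine squeeze_zero (fun n => norm_nonneg _) hb ?_
    have : (2 : ℝ) ^ (-(a - α)) < 1 :=
      Real.rpow_lt_one_of_one_lt_of_neg (by norm_num) (by linarith [I.ha, I.hτ, I.hδ])
    simpa using (tendsto_pow_atTop_nhds_zero_of_lt_one (by positivity) this).const_mul
      (algConst d α (2 ^ a) * (I.K * I.ε))
  have hUn : wNorm B (powWeight (a - τ - 11 * I.δ)) (mat U) ≤
      ENNReal.ofReal (2 * γ⁻¹ * I.K * I.ε * (1 - I.ρ)⁻¹) := by
    refine (wNorm_le_tsum B _ (hasSum_mat hVs.hasSum)).trans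
      ((ENNReal.tsum_le_tsum hVd).trans (le_of_eq ?_))
    rw [← ENNReal.ofReal_tsum_of_nonneg (fun n => by positivity) (hgeo.summable.mul_left _),
      tsum_mul_left, hgeo.tsum_eq]
  have hρ' : 0 < 1 - I.ρ := by linarith
  have hM4 : algConst d α (2 ^ a) * (2 * γ⁻¹ * I.K * I.ε * (1 - I.ρ)⁻¹) ≤ 1 / 4 := by
    rw [← mul_assoc, ← div_eq_mul_inv, div_le_iff₀ hρ']
    linarith [I.h_quarter]
  have hpos : 0 ≤ 2 * γ⁻¹ * I.K * I.ε * (1 - I.ρ)⁻¹ := by positivity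
  refine ⟨q, 1 + U, ?_, ?_, ?_, fun i k => ?_, fun hp hTr i => ?_⟩
  · refine (B.extNorm_le_tsum fun i => (hQs i).hasSum).trans
      ((ENNReal.tsum_le_tsum hQd).trans (le_of_eq ?_))
    rw [← ENNReal.ofReal_tsum_of_nonneg (fun n => by positivity) (hgeo.summable.mul_left _),
      tsum_mul_left, hgeo.tsum_eq]
  · rw [add_sub_cancel_left]
    refine hUn.trans (ENNReal.ofReal_le_ofReal ?_)
    nlinarith
  · rw [add_sub_cancel_left]
    exact (norm_le_of_wNorm_le I.hα hc2 I.isAlgWeight_target.le hpos hUn).trans hM4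
  · have h1 : Filter.Tendsto (fun n => mat (T * V n) i k + p i * mat (V n) i k
        - mat (V n) i k * (Q n + p) k) Filter.atTop
        (nhds (mat (T * (1 + U)) i k + p i * mat (1 + U) i k - mat (1 + U) i k * (q + p) k)) := by
      have hVm := ((continuous_mat i k).tendsto _).comp hVlim
      have hTV := ((continuous_mat i k).tendsto _).comp (hVlim.const_mul T)
      exact (hTV.add (hVm.const_mul (p i))).sub (hVm.mul ((hQlim k).add_const (p k)))
    have h2 : Filter.Tendsto (fun n => mat (V n * R n) i k) Filter.atTop (nhds 0) := by
      have := ((continuous_mat i k).tendsto _).comp (hVlim.mul hRlim)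
      have e : mat ((1 + U) * (0 : EllTwo d →L[ℂ] EllTwo d)) i k = 0 := by simp [mat]
      rwa [e] at this
    exact tendsto_nhds_unique h1 (h2.congr fun n => ((hS n).conj i k).symm)
  · exact im_eq_zero_of_hasSum (hQs i).hasSum fun n => by
      rw [Complex.sub_im, ((hS (n + 1)).real hp hTr).1 i, ((hS n).real hp hTr).1 i, sub_zero]

lemma mem_diagonalClass (B : SequenceAlgebra d) {q : Lattice d → ℂ} (hq : B.extNorm q ≠ ⊤) :
    diagMatrix q ∈ diagonalClass B := by
  refine ⟨fun s _ => ?_, fun i j hij => if_neg hij⟩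
  change sobolevNorm B s _ < ⊤
  rw [sobolevNorm_eq_wNorm, wNorm_diagMatrix]
  exact (ENNReal.mul_ne_top hq ENNReal.ofReal_ne_top).lt_top

lemma sobolevNorm_zero_diagMatrix (B : SequenceAlgebra d) (q : Lattice d → ℂ) :
    sobolevNorm B 0 (diagMatrix q) = B.extNorm q := by
  rw [sobolevNorm_eq_wNorm, wNorm_diagMatrix]
  simp [powWeight]

lemma kDiagonal_hoppingMatrix (φ : Lattice d → ℝ) (k : Lattice d) :
    kDiagonal (hoppingMatrix φ) k = fun _ => (φ k : ℂ) := by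
  funext i
  simp [kDiagonal, hoppingMatrix]

lemma wNorm_hoppingMatrix_neg (B : SequenceAlgebra d) (s : ℝ) (φ : Lattice d → ℝ) :
    wNorm B (powWeight s) (hoppingMatrix fun k => φ (-k)) =
      wNorm B (powWeight s) (hoppingMatrix φ) := by
  simp only [wNorm, kDiagonal_hoppingMatrix]
  rw [← ellNorm_comp_equiv (Equiv.neg (Lattice d)) fun k =>
    B.extNorm (fun _ => (φ k : ℂ)) * ENNReal.ofReal (powWeight s k)]
  simp only [Equiv.neg_apply, powWeight, bracket_neg]

/-- Diagonalization of small power-law perturbations of a distal diagonal operator. -/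
theorem exists_diagonalization {α τ δ a γ η : ℝ} (hα : (d : ℝ) / 2 < α) (hτ : 0 < τ) (hδ : 0 < δ)
    (ha : α + τ + 11 * δ < a) (hγ : 0 < γ) (hη : 0 < η) :
    ∃ ε₁ C : ℝ, 0 < ε₁ ∧ 0 < C ∧ ∀ (B : SequenceAlgebra d) (φ : Lattice d → ℝ)
      (p : Lattice d → ℂ) (ε : ℝ), φ 0 = 0 →
      (∀ q : Lattice d → ℂ, diagMatrix q ∈ diagonalClass B →
        sobolevNorm B 0 (diagMatrix q) ≤ ENNReal.ofReal η → IsDistal B τ γ (q + p)) →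
      0 ≤ ε → ε ≤ ε₁ → wNorm B (powWeight a) (hoppingMatrix φ) ≤ ENNReal.ofReal ε →
      ∃ (q : Lattice d → ℂ) (T V : EllTwo d →L[ℂ] EllTwo d),
        mat T = hoppingMatrix φ ∧
        B.extNorm q ≤ ENNReal.ofReal (C * ε ^ 2) ∧
        wNorm B (powWeight (a - τ - 11 * δ)) (mat (V - 1)) ≤ ENNReal.ofReal (1 / 4) ∧
        ‖V - 1‖ ≤ 1 / 4 ∧
        (∀ i k, mat (T * V) i k + p i * mat V i k - mat V i k * (q + p) k = 0) ∧
        ((∀ i, (p i).im = 0) → ∀ i, (q i).im = 0) := by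
  set M := algConst d α (2 ^ a) with hM
  have hc2 : (0 : ℝ) ≤ 2 ^ a := by positivity
  have hM1 : 1 ≤ M := one_le_algConst hc2
  have hM0 : 0 < M := by linarith
  have hα0 : 0 ≤ α := (by positivity : (0 : ℝ) ≤ (d : ℝ) / 2).trans hα.le
  set K : ℝ := 5 * 2 ^ (a - α) with hK
  have hK0 : 0 < K := by positivity
  set A := 6 * M * γ⁻¹ * K ^ 2 with hA
  have hA0 : 0 < A := by positivity
  set ρ : ℝ := 2 ^ (-(11 * δ)) with hρ
  have hρ0 : 0 < ρ := by positivity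
  have hρ1 : ρ < 1 := Real.rpow_lt_one_of_one_lt_of_neg (by norm_num) (by linarith)
  have hρ2 : 0 < 1 - ρ := by linarith
  set L := M * (γ⁻¹ * K) with hL
  have hL0 : 0 < L := by positivity
  refine ⟨min (min ((1 - ρ) / A) (1 / (2 * L))) (min (min 1 (η * (1 - ρ) / (A / ρ)))
    ((1 - ρ) / (8 * L))), A / ρ * (1 - ρ)⁻¹, by positivity, by positivity,
    fun B φ p ε hφ hdist hε hε1 hφn => ?_⟩
  simp only [le_min_iff] at hε1
  obtain ⟨⟨h1, h2⟩, ⟨h3, h4⟩, h5⟩ := hε1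
  rw [le_div_iff₀ (by positivity)] at h1 h2 h4 h5
  obtain ⟨T, hT, -⟩ := exists_operator_of_wNorm_le hα hc2
    (powWeight_mono (by linarith : α ≤ a)) hε hφn
  let I : IterationData d τ γ α a :=
    { δ, K, A, ρ, ε, η, hδ, hα, hτ, hγ, ha, hε
      hK := rfl
      hA := rfl
      hρ := rfl
      h_small := by linarith
      h_half := by
        calc M * (γ⁻¹ * K * ε) = ε * (2 * L) / 2 := by rw [hL]; ring
          _ ≤ 1 / 2 := by linarith
      h_eta := by
        calc A / ρ * ε ^ 2 = ε * (A / ρ) * ε := by ring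
          _ ≤ ε * (A / ρ) * 1 := by gcongr
          _ ≤ η * (1 - ρ) := by linarith
      h_quarter := by
        calc M * (2 * γ⁻¹ * K * ε) = ε * (8 * L) / 4 := by rw [hL]; ring
          _ ≤ (1 - ρ) / 4 := by linarith }
  obtain ⟨q, V, hq, hV, hV', hconj, hreal⟩ := exists_limit_of_isApprox I (B := B) (p := p) (T := T)
    (fun q hq => hdist q (mem_diagonalClass B (hq.trans_lt ENNReal.ofReal_lt_top).ne)
      (by rwa [sobolevNorm_zero_diagMatrix])) (hT ▸ hφn)
    (fun i => by rw [hT, hoppingMatrix, sub_self, hφ, Complex.ofReal_zero])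
  refine ⟨q, T, V, hT, hq.trans_eq ?_, hV, hV', hconj, fun hp => hreal hp fun i j => ?_⟩
  · congr 1
    change A / ρ * ε ^ 2 * (1 - ρ)⁻¹ = A / ρ * (1 - ρ)⁻¹ * ε ^ 2
    ring
  · rw [hT]
    exact Complex.ofReal_im _

/-! ### The operator `T + D`, its domain and its eigenfunctions. -/

section Hamiltonian

variable {φ : Lattice d → ℝ} {p : Lattice d → ℂ} {T : EllTwo d →L[ℂ] EllTwo d}

lemma hasSum_diagMatrix_mul (p : Lattice d → ℂ) (u : Lattice d → ℂ) (i : Lattice d) :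
    HasSum (fun j => diagMatrix p i j * u j) (p i * u i) := by
  convert hasSum_single i fun j hj => ?_ using 1
  · simp [diagMatrix]
  · simp [diagMatrix, hj.symm]

lemma mem_hamiltonian_domain (hT : mat T = hoppingMatrix φ) (u : EllTwo d) :
    u ∈ (hamiltonian φ p).domain ↔ Memℓp (fun i => p i * u i) 2 := by
  have h1 : u ∈ (matrixOperator (hoppingMatrix φ)).domain := by
    rw [← hT]
    refine ⟨fun i => (hasSum_mat_mul T u i).summable, ?_⟩
    simp only [(hasSum_mat_mul T u _).tsum_eq]
    exact lp.memℓp (T u)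
  have h2 : u ∈ (matrixOperator (diagMatrix p)).domain ↔ Memℓp (fun i => p i * u i) 2 := by
    have e : (fun i => ∑' j, diagMatrix p i j * u j) = fun i => p i * u i :=
      funext fun i => (hasSum_diagMatrix_mul p u i).tsum_eq
    constructor
    · rintro ⟨-, h⟩
      rwa [e] at h
    · intro h
      refine ⟨fun i => (hasSum_diagMatrix_mul p u i).summable, ?_⟩
      rwa [e]
  rw [← h2]
  exact ⟨fun h => h.2, fun h => ⟨h1, h⟩⟩

lemma hamiltonian_apply (hT : mat T = hoppingMatrix φ) (u : (hamiltonian φ p).domain)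
    (i : Lattice d) : hamiltonian φ p u i = T (u : EllTwo d) i + p i * (u : EllTwo d) i := by
  have h : hamiltonian φ p u i = (∑' j, hoppingMatrix φ i j * (u : EllTwo d) j) +
      ∑' j, diagMatrix p i j * (u : EllTwo d) j := rfl
  rw [h, ← hT, (hasSum_mat_mul T u i).tsum_eq, (hasSum_diagMatrix_mul p u i).tsum_eq]

/-- To solve `H u = v` it is enough to solve it coordinatewise. -/
lemma exists_hamiltonian_eq (hT : mat T = hoppingMatrix φ) {u v : EllTwo d}
    (h : ∀ i, T u i + p i * u i = v i) :
    ∃ hu : u ∈ (hamiltonian φ p).domain, hamiltonian φ p ⟨u, hu⟩ = v := by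
  have hu : u ∈ (hamiltonian φ p).domain := by
    rw [mem_hamiltonian_domain hT]
    have e : (fun i => p i * u i) = ((v - T u : EllTwo d) : Lattice d → ℂ) := by
      funext i
      rw [lp.coeFn_sub, Pi.sub_apply, ← h i]
      ring
    rw [e]
    exact lp.memℓp _
  refine ⟨hu, ?_⟩
  ext i
  rw [hamiltonian_apply hT, h]

end Hamiltonian

lemma dense_span_unitVec :
    Dense (Submodule.span ℂ (Set.range (unitVec (d := d))) : Set (EllTwo d)) := by
  intro u
  refine mem_closure_of_tendsto (hasSum_unitVec u) (Filter.Eventually.of_forall fun s => ?_)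
  exact Submodule.sum_mem _ fun j _ => Submodule.smul_mem _ _ (Submodule.subset_span ⟨j, rfl⟩)

lemma isUnit_of_norm_sub_one_le {V : EllTwo d →L[ℂ] EllTwo d} (hV : ‖V - 1‖ ≤ 1 / 4) :
    IsUnit V := by
  have := isUnit_one_sub_of_norm_lt_one (x := 1 - V) (by rw [norm_sub_rev]; linarith)
  rwa [sub_sub_cancel] at this

/-- `V` is invertible, hence maps a dense span onto a dense span. -/
lemma isCompleteSet_range {V : EllTwo d →L[ℂ] EllTwo d} (hV : ‖V - 1‖ ≤ 1 / 4) :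
    IsCompleteSet (Set.range fun k => V (unitVec k)) := by
  obtain ⟨W, hW⟩ := (isUnit_of_norm_sub_one_le hV).exists_right_inv
  have hs : Function.Surjective V := fun u => ⟨W u, DFunLike.congr_fun hW u⟩
  have h1 := hs.denseRange.dense_image V.continuous dense_span_unitVec
  have h2 : V '' (Submodule.span ℂ (Set.range (unitVec (d := d))) : Set (EllTwo d)) =
      Submodule.span ℂ (Set.range fun k => V (unitVec k)) := by
    have := Submodule.map_span (V : EllTwo d →ₗ[ℂ] EllTwo d) (Set.range (unitVec (d := d)))
    rw [← Set.range_comp] at this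
    exact congrArg (fun S : Submodule ℂ (EllTwo d) => (S : Set (EllTwo d))) this
  rw [h2] at h1
  exact h1

lemma norm_image_unitVec_sub_le {V : EllTwo d →L[ℂ] EllTwo d} (hV : ‖V - 1‖ ≤ 1 / 4)
    (k : Lattice d) : ‖V (unitVec k) - unitVec k‖ ≤ 1 / 4 := by
  have := (V - 1).le_opNorm (unitVec k)
  rw [norm_unitVec, mul_one] at this
  exact this.trans hV

lemma image_unitVec_ne_zero {V : EllTwo d →L[ℂ] EllTwo d} (hV : ‖V - 1‖ ≤ 1 / 4) (k : Lattice d) :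
    V (unitVec k) ≠ 0 := fun h => by
  have := norm_image_unitVec_sub_le hV k
  rw [h, zero_sub, norm_neg, norm_unitVec] at this
  norm_num at this

lemma isEigenfunction_image_unitVec {φ : Lattice d → ℝ} {p p' : Lattice d → ℂ}
    {T V : EllTwo d →L[ℂ] EllTwo d} (hT : mat T = hoppingMatrix φ) (hV : ‖V - 1‖ ≤ 1 / 4)
    (hconj : ∀ i k, mat (T * V) i k + p i * mat V i k - mat V i k * p' k = 0) (k : Lattice d) :
    IsEigenfunction (hamiltonian φ p) (p' k) (V (unitVec k)) := by
  refine ⟨image_unitVec_ne_zero hV k, exists_hamiltonian_eq hT fun i => ?_⟩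
  rw [lp.coeFn_smul, Pi.smul_apply, smul_eq_mul, mul_comm (p' k)]
  exact sub_eq_zero.1 (hconj i k)

/-! ### Left eigenfunctions and the spectrum. -/

/-- The bilinear pairing `∑_j w_j u_j` on `ℓ²`. -/
def pairing (w : EllTwo d) : EllTwo d →L[ℂ] ℂ := innerSL ℂ (star w)

lemma hasSum_pairing (w u : EllTwo d) : HasSum (fun j => w j * u j) (pairing w u) := by
  have := lp.hasSum_inner (𝕜 := ℂ) (star w) u
  refine this.congr_fun fun j => ?_
  simp [mul_comm]

lemma pairing_comm (w u : EllTwo d) : pairing w u = pairing u w := by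
  refine (hasSum_pairing w u).unique ?_
  simpa only [mul_comm] using hasSum_pairing u w

lemma pairing_unitVec (w : EllTwo d) (j : Lattice d) : pairing w (unitVec j) = w j := by
  refine (hasSum_pairing w (unitVec j)).unique ?_
  convert hasSum_single j fun i hi => ?_ using 1
  · simp [unitVec_apply]
  · simp [unitVec_apply, hi]

lemma norm_pairing_le (w u : EllTwo d) : ‖pairing w u‖ ≤ ‖w‖ * ‖u‖ := by
  have := norm_inner_le_norm (𝕜 := ℂ) (star w) u
  rwa [norm_star] at this

lemma pairing_transpose {T T' : EllTwo d →L[ℂ] EllTwo d} (h : ∀ i j, mat T' i j = mat T j i)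
    (u w : EllTwo d) : pairing u (T w) = pairing (T' u) w := by
  rw [pairing_comm, pairing_comm (T' u)]
  have h1 := (hasSum_unitVec u).mapL (pairing (T w))
  have h2 := (hasSum_unitVec u).mapL ((pairing w).comp T')
  refine h1.unique ?_
  refine h2.congr_fun fun j => ?_
  simp only [ContinuousLinearMap.comp_apply, map_smul]
  rw [pairing_unitVec, pairing_comm]
  congr 1
  refine (hasSum_mat_mul T w j).unique ?_
  refine (hasSum_pairing (T' (unitVec j)) w).congr_fun fun i => ?_
  rw [← h i j, mat]

lemma pairing_image_ne_zero {V V' : EllTwo d →L[ℂ] EllTwo d} (hV : ‖V - 1‖ ≤ 1 / 4)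
    (hV' : ‖V' - 1‖ ≤ 1 / 4) (k : Lattice d) :
    pairing (V' (unitVec k)) (V (unitVec k)) ≠ 0 := by
  have h := norm_image_unitVec_sub_le hV k
  have h' := norm_image_unitVec_sub_le hV' k
  set e := V (unitVec k)
  set e' := V' (unitVec k)
  have h1 : pairing e' e =
      pairing e' (e - unitVec k) + pairing (unitVec k) (e' - unitVec k) + 1 := by
    rw [map_sub, map_sub, pairing_comm (unitVec k) e', pairing_unitVec (unitVec k) k,
      unitVec_apply, if_pos rfl]
    ring
  have h2 := norm_pairing_le e' (e - unitVec k)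
  have h3 := norm_pairing_le (unitVec k) (e' - unitVec k)
  have h4 : ‖e'‖ ≤ 5 / 4 := by
    have := norm_add_le (e' - unitVec k) (unitVec k)
    rw [sub_add_cancel, norm_unitVec] at this
    linarith
  rw [norm_unitVec, one_mul] at h3
  intro h0
  have h5 : ‖pairing e' (e - unitVec k) + pairing (unitVec k) (e' - unitVec k)‖ = 1 := by
    rw [h0] at h1
    rw [← norm_neg, ← norm_one (α := ℂ)]
    congr 1
    linear_combination h1
  have h6 := norm_add_le (pairing e' (e - unitVec k)) (pairing (unitVec k) (e' - unitVec k))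
  -- The error is at most `5/4 · 1/4 + 1/4 = 9/16 < 1`.
  nlinarith [norm_nonneg e', norm_nonneg (e - unitVec k)]

section Spectrum

variable {p p' p'' : Lattice d → ℂ} {T T' V V' : EllTwo d →L[ℂ] EllTwo d}

/-- The eigenfunctions of the transposed operator are left eigenfunctions. -/
lemma pairing_left_eigenfunction (htr : ∀ i j, mat T' i j = mat T j i)
    (hconj' : ∀ i k, mat (T' * V') i k + p i * mat V' i k - mat V' i k * p'' k = 0)
    {w v : EllTwo d} (h : ∀ i, T w i + p i * w i = v i) (k : Lattice d) :
    pairing (V' (unitVec k)) v = p'' k * pairing (V' (unitVec k)) w := by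
  set e := V' (unitVec k)
  have h1 := ((hasSum_pairing e (T w)).add ((hasSum_pairing e w).mul_left (p'' k))).sub
    (hasSum_pairing (T' e) w)
  rw [pairing_transpose htr, add_sub_cancel_left] at h1
  refine (hasSum_pairing e v).unique ?_
  refine h1.congr_fun fun j => ?_
  have h2 : T' e j + p j * e j - e j * p'' k = 0 := hconj' j k
  rw [← h j]
  linear_combination w j * h2

/-- Evaluating the pairing of the `k`-th left eigenfunction with `H` applied to the `k`-th right one
in two ways gives `p' k = p'' k`, because the two vectors are near the same unit vector and so pair
nontrivially. -/
lemma eigenvalues_transpose_eq (htr : ∀ i j, mat T' i j = mat T j i)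
    (hV : ‖V - 1‖ ≤ 1 / 4) (hV' : ‖V' - 1‖ ≤ 1 / 4)
    (hconj : ∀ i k, mat (T * V) i k + p i * mat V i k - mat V i k * p' k = 0)
    (hconj' : ∀ i k, mat (T' * V') i k + p i * mat V' i k - mat V' i k * p'' k = 0) : p'' = p' := by
  funext k
  have h := pairing_left_eigenfunction htr hconj' (w := V (unitVec k)) (v := p' k • V (unitVec k))
    (fun i => by
      rw [lp.coeFn_smul, Pi.smul_apply, smul_eq_mul, mul_comm (p' k)]
      exact sub_eq_zero.1 (hconj i k)) k
  rw [map_smul, smul_eq_mul] at h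
  exact (mul_right_cancel₀ (pairing_image_ne_zero hV hV' k) h).symm

/-- An eigenvector for `z` is annihilated by every left eigenfunction, as their eigenvalues differ
from `z`, and these are complete. This avoids asking whether `V⁻¹` preserves the domain of `D`. -/
lemma eq_zero_of_eigen (htr : ∀ i j, mat T' i j = mat T j i) (hV' : ‖V' - 1‖ ≤ 1 / 4)
    (hconj' : ∀ i k, mat (T' * V') i k + p i * mat V' i k - mat V' i k * p' k = 0)
    {z : ℂ} (hz : ∀ k, p' k ≠ z) {w : EllTwo d} (h : ∀ i, T w i + p i * w i = z * w i) : w = 0 := by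
  have h0 : ∀ k, pairing w (V' (unitVec k)) = 0 := fun k => by
    have h1 := pairing_left_eigenfunction htr hconj' (w := w) (v := z • w) (fun i => by
      rw [lp.coeFn_smul, Pi.smul_apply, smul_eq_mul, h]) k
    rw [map_smul, smul_eq_mul] at h1
    rw [pairing_comm]
    exact (mul_eq_zero.1 (by linear_combination h1 :
      (z - p' k) * pairing (V' (unitVec k)) w = 0)).resolve_left (sub_ne_zero.2 (hz k).symm)
  have h1 : pairing w = 0 := by
    refine ContinuousLinearMap.ext_on (isCompleteSet_range hV') ?_
    rintro _ ⟨k, rfl⟩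
    exact h0 k
  ext j
  rw [← pairing_unitVec, h1]
  rfl

lemma operatorSpectrum_hamiltonian {φ : Lattice d → ℝ} (hT : mat T = hoppingMatrix φ)
    (htr : ∀ i j, mat T' i j = mat T j i) (hV : ‖V - 1‖ ≤ 1 / 4) (hV' : ‖V' - 1‖ ≤ 1 / 4)
    (hconj : ∀ i k, mat (T * V) i k + p i * mat V i k - mat V i k * p' k = 0)
    (hconj' : ∀ i k, mat (T' * V') i k + p i * mat V' i k - mat V' i k * p'' k = 0) :
    operatorSpectrum (hamiltonian φ p) = closure (Set.range p') := by
  obtain rfl := eigenvalues_transpose_eq htr hV hV' hconj hconj'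
  ext z
  constructor
  · intro hz
    by_contra hcl
    apply hz
    obtain ⟨r, hr, hball⟩ : ∃ r > 0, ∀ k, r ≤ ‖p'' k - z‖ := by
      rw [Metric.mem_closure_iff] at hcl
      push Not at hcl
      obtain ⟨r, hr, h⟩ := hcl
      refine ⟨r, hr, fun k => ?_⟩
      rw [← dist_eq_norm, dist_comm]
      exact h _ ⟨k, rfl⟩
    have hne : ∀ k, p'' k ≠ z := fun k h => by
      have := hball k
      rw [h, sub_self, norm_zero] at this
      linarith
    obtain ⟨W, hW⟩ := (isUnit_of_norm_sub_one_le hV).exists_right_inv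
    obtain ⟨G, hG, -⟩ := exists_diagonal_operator 0 (fun k => (p'' k - z)⁻¹) r⁻¹ fun k => by
      rw [norm_inv]
      exact inv_anti₀ hr (hball k)
    -- The candidate resolvent is `V diag (1/(p'' - z)) V⁻¹`; it solves `(H - z) u = v`
    -- coordinatewise, which already puts `u` in the domain.
    have hR : ∀ v i, T ((V * G * W) v) i + p i * (V * G * W) v i = (v + z • (V * G * W) v) i := by
      intro v i
      set u := G (W v) with hu
      have hu' : ∀ k, p'' k * u k = z * u k + W v k := fun k => by
        have h0 := sub_ne_zero.2 (hne k)
        have h1 : u k = (p'' k - z)⁻¹ * W v k := by rw [hu, hG, sub_zero]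
        have h2 : (p'' k - z) * u k = W v k := by rw [h1, mul_inv_cancel_left₀ h0]
        linear_combination h2
      have h1 := (hasSum_mat_mul V u i).mul_left (p i)
      have h2 := (((hasSum_mat_mul V u i).mul_left z).add (hasSum_mat_mul V (W v) i)).sub
        (hasSum_mat_mul (T * V) u i)
      have h3 : p i * V u i = z * V u i + V (W v) i - (T * V) u i := by
        refine h1.unique ?_
        refine h2.congr_fun fun k => ?_
        linear_combination u k * hconj i k + mat V i k * hu' k
      have h4 : V (W v) = v := DFunLike.congr_fun hW v
      have h5 : (T * V) u = T (V u) := rfl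
      rw [h4, h5] at h3
      have h6 : (V * G * W) v = V u := rfl
      rw [h6, lp.coeFn_add, Pi.add_apply, lp.coeFn_smul, Pi.smul_apply, smul_eq_mul]
      linear_combination h3
    refine ⟨V * G * W, fun v => ?_, fun u => ?_⟩
    · obtain ⟨hu, h⟩ := exists_hamiltonian_eq hT (hR v)
      exact ⟨hu, by rw [h, add_sub_cancel_right]⟩
    · refine sub_eq_zero.1 (eq_zero_of_eigen htr hV' hconj' hne fun i => ?_)
      have h1 := hR (hamiltonian φ p u - z • (u : EllTwo d)) i
      set y := (V * G * W) (hamiltonian φ p u - z • (u : EllTwo d))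
      have h2 := hamiltonian_apply hT u i
      simp only [map_sub, lp.coeFn_sub, lp.coeFn_add, lp.coeFn_smul, Pi.sub_apply, Pi.add_apply,
        Pi.smul_apply, smul_eq_mul] at h1 ⊢
      linear_combination h1 + h2
  -- A bounded resolvent `R` at `z` forces `1 ≤ |p'' k - z| ‖R‖` for every eigenvalue, so none lies
  -- within `1/(‖R‖ + 1)` of `z`.
  · rintro hz ⟨R, -, hR⟩
    rw [Metric.mem_closure_iff] at hz
    obtain ⟨_, ⟨k, rfl⟩, hk⟩ := hz (1 / (‖R‖ + 1)) (by positivity)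
    obtain ⟨he, hdom, hHe⟩ := isEigenfunction_image_unitVec hT hV hconj k
    have h1 : R (hamiltonian φ p ⟨_, hdom⟩ - z • V (unitVec k)) = V (unitVec k) := hR ⟨_, hdom⟩
    rw [hHe, ← sub_smul, map_smul] at h1
    have h2 : ‖V (unitVec k)‖ ≤ ‖p'' k - z‖ * (‖R‖ * ‖V (unitVec k)‖) := by
      conv_lhs => rw [← h1]
      rw [norm_smul]
      gcongr
      exact R.le_opNorm _
    have h3 : 0 < ‖V (unitVec k)‖ := norm_pos_iff.2 he
    rw [dist_comm, dist_eq_norm, lt_div_iff₀ (by positivity)] at hk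
    nlinarith [norm_nonneg (p'' k - z), norm_nonneg R]

end Spectrum

/-! ### Decay of the eigenfunctions and the final bounds. -/

lemma norm_mat_apply_le {B : SequenceAlgebra d} {b : ℝ}
    {V : EllTwo d →L[ℂ] EllTwo d}
    (hV : wNorm B (powWeight b) (mat (V - 1)) ≤ ENNReal.ofReal (1 / 4)) (i k : Lattice d) :
    ‖V (unitVec k) i‖ ≤ 2 * bracket (i - k) ^ (-b) := by
  have hw := powWeight_pos b (i - k)
  have h1 : ‖mat (V - 1) i k‖ * powWeight b (i - k) ≤ 1 / 4 := by
    rw [← ENNReal.ofReal_le_ofReal_iff (by norm_num), ENNReal.ofReal_mul (norm_nonneg _)]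
    refine le_trans ?_ ((extNorm_le_wNorm B _ _ (i - k)).trans hV)
    gcongr
    have := B.ofReal_norm_le_extNorm (kDiagonal (mat (V - 1)) (i - k)) i
    rwa [kDiagonal, sub_sub_cancel] at this
  have e : V (unitVec k) i = mat (V - 1) i k + mat 1 i k := by
    rw [← mat_add, sub_add_cancel]
    rfl
  rw [Real.rpow_neg (bracket_pos _).le, ← div_eq_mul_inv, e]
  refine (le_div_iff₀ hw).2 ?_
  have h2 : ‖mat (1 : EllTwo d →L[ℂ] EllTwo d) i k‖ * powWeight b (i - k) ≤ 1 := by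
    rw [mat_one]
    by_cases h : i = k
    · subst h
      simp [powWeight, bracket_zero]
    · simp [h]
  have h3 := mul_le_mul_of_nonneg_right
    (norm_add_le (mat (V - 1) i k) (mat (1 : EllTwo d →L[ℂ] EllTwo d) i k)) hw.le
  linarith

/-- For `κ > 1/2` the exponent `1/κ` is below `2`, so the surplus power `ε^{2 - 1/κ}` absorbs `C`.
-/
lemma mul_sq_le_rpow {C ε κ : ℝ} (hC : 0 < C) (hε : 0 ≤ ε) (hκ : 1 / 2 < κ)
    (h : ε ≤ C⁻¹ ^ (1 / (2 - 1 / κ))) : C * ε ^ 2 ≤ ε ^ (1 / κ) := by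
  have hκ0 : 0 < κ := by linarith
  have hθ : 0 < 2 - 1 / κ := by
    have : 1 / κ < 2 := by
      rw [div_lt_iff₀ hκ0]
      linarith
    linarith
  have h1 : ε ^ (2 - 1 / κ) ≤ C⁻¹ := by
    refine (Real.rpow_le_rpow hε h hθ.le).trans_eq ?_
    rw [← Real.rpow_mul (inv_nonneg.2 hC.le), one_div_mul_cancel hθ.ne', Real.rpow_one]
  have h2 : ε ^ 2 = ε ^ (2 - 1 / κ) * ε ^ (1 / κ) := by
    rw [← Real.rpow_add_of_nonneg hε hθ.le (by positivity), ← Real.rpow_natCast]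
    congr 1
    push_cast
    ring
  calc C * ε ^ 2 = C * ε ^ (2 - 1 / κ) * ε ^ (1 / κ) := by rw [h2]; ring
    _ ≤ C * C⁻¹ * ε ^ (1 / κ) := by gcongr
    _ = ε ^ (1 / κ) := by rw [mul_inv_cancel₀ hC.ne', one_mul]

end PowerLaw

end

theorem corollary2p4 (d : ℕ) (hd : 1 ≤ d) (α₀ τ δ s : ℝ) (hα₀ : (d : ℝ) / 2 < α₀)
    (hτ : 0 < τ) (hδ : 0 < δ) (hs : α₀ + τ + (d : ℝ) / 2 + 12 * δ < s) :
    ∃ C : ℝ, 0 < C ∧ ∀ γ η : ℝ, 0 < γ → 0 < η → ∃ ε₀ : ℝ, 0 < ε₀ ∧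
      ∀ (B : PowerLaw.SequenceAlgebra d) (φ : PowerLaw.Lattice d → ℝ)
        (p : PowerLaw.Lattice d → ℂ),
        φ 0 = 0 →
        (∀ i, i ≠ 0 → |φ i| ≤ ‖i‖ ^ (-s)) →
        PowerLaw.IsDistal B τ γ p →
        (∀ q : PowerLaw.Lattice d → ℂ,
          PowerLaw.diagMatrix q ∈ PowerLaw.diagonalClass B →
          PowerLaw.sobolevNorm B 0 (PowerLaw.diagMatrix q) ≤ ENNReal.ofReal η →
          PowerLaw.IsDistal B τ γ (q + p)) →
        PowerLaw.sobolevNorm B (s - (d : ℝ) / 2 - δ) (PowerLaw.hoppingMatrix φ)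
          ≤ ENNReal.ofReal ε₀ →
        ∃ p' : PowerLaw.Lattice d → ℂ,
          PowerLaw.diagMatrix (p' - p) ∈ PowerLaw.diagonalClass B ∧
          PowerLaw.sobolevNorm B 0 (PowerLaw.diagMatrix (p - p')) ≤
            ENNReal.ofReal C *
              PowerLaw.sobolevNorm B (s - (d : ℝ) / 2 - δ) (PowerLaw.hoppingMatrix φ) ∧
          (1 / 2 < s - (d : ℝ) / 2 - 5 * δ - α₀ →
            PowerLaw.sobolevNorm B 0 (PowerLaw.diagMatrix (p - p')) ≤
              ENNReal.ofReal C *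
                PowerLaw.sobolevNorm B (s - (d : ℝ) / 2 - δ) (PowerLaw.hoppingMatrix φ)
                  ^ (1 / (s - (d : ℝ) / 2 - 5 * δ - α₀))) ∧
          PowerLaw.HasPurePointSpectrum (PowerLaw.hamiltonian φ p) ∧
          (∃ e : PowerLaw.Lattice d → PowerLaw.EllTwo d,
            (∀ k, PowerLaw.IsEigenfunction (PowerLaw.hamiltonian φ p) (p' k) (e k)) ∧
            PowerLaw.IsCompleteSet (Set.range e) ∧
            ∀ i k, ‖e k i‖ ≤
              2 * PowerLaw.bracket (i - k) ^ (-s + τ + (d : ℝ) / 2 + 12 * δ)) ∧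
          ((∀ i, (p i).im = 0) →
            (∀ i, (p' i).im = 0) ∧
            PowerLaw.operatorSpectrum (PowerLaw.hamiltonian φ p) =
              Complex.ofReal '' closure (Set.range fun i => (p' i).re)) := by
  -- The correction is quadratic in `ε`, with a constant depending on `γ`. Shrinking `ε₀` absorbs
  -- that constant, so `1` serves in both bounds.
  refine ⟨1, one_pos, fun γ η hγ hη => ?_⟩
  set a := s - (d : ℝ) / 2 - δ with ha
  set κ := s - (d : ℝ) / 2 - 5 * δ - α₀ with hκ
  obtain ⟨ε₁, C, hε₁, hC, hmain⟩ := PowerLaw.exists_diagonalization (η := η) hα₀ hτ hδ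
    (by linarith : α₀ + τ + 11 * δ < a) hγ hη
  have hCpos : 0 < C⁻¹ ^ (1 / (2 - 1 / κ)) := Real.rpow_pos_of_pos (inv_pos.2 hC) _
  -- The second threshold gives `C ε² ≤ ε` and the third `C ε² ≤ ε^{1/κ}`; when `κ ≤ 1/2` the third
  -- is merely some positive number.
  refine ⟨min ε₁ (min C⁻¹ (C⁻¹ ^ (1 / (2 - 1 / κ)))), by positivity,
    fun B φ p hφ _ _ hdist hsmall => ?_⟩
  have hfin := hsmall.trans_lt ENNReal.ofReal_lt_top
  set ε := (PowerLaw.sobolevNorm B a (PowerLaw.hoppingMatrix φ)).toReal with hεdef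
  have hε : 0 ≤ ε := ENNReal.toReal_nonneg
  have hεeq : PowerLaw.sobolevNorm B a (PowerLaw.hoppingMatrix φ) = ENNReal.ofReal ε :=
    (ENNReal.ofReal_toReal hfin.ne).symm
  have hεle : ε ≤ _ := ENNReal.toReal_le_of_le_ofReal (by positivity) hsmall
  simp only [le_min_iff] at hεle
  obtain ⟨h1, h2, h3⟩ := hεle
  have hφn := (PowerLaw.sobolevNorm_eq_wNorm B a (PowerLaw.hoppingMatrix φ)).symm.trans hεeq |>.le
  obtain ⟨q, T, V, hT, hq, hVn, hV, hconj, hreal⟩ := hmain B φ p ε hφ hdist hε h1 hφn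
  -- Reflecting `φ` transposes the hopping matrix and preserves its norm, so the same threshold
  -- applies.
  obtain ⟨q', T', V', hT', -, -, hV', hconj', -⟩ := hmain B (fun k => φ (-k)) p ε
    (by simpa using hφ) hdist hε h1 ((PowerLaw.wNorm_hoppingMatrix_neg B a φ).le.trans hφn)
  have hqn : PowerLaw.sobolevNorm B 0 (PowerLaw.diagMatrix (p - (q + p))) ≤
      ENNReal.ofReal (C * ε ^ 2) := by
    rw [PowerLaw.sobolevNorm_zero_diagMatrix]
    have e : p - (q + p) = -q := by abel
    rwa [e, B.extNorm_neg]
  have heig := PowerLaw.isEigenfunction_image_unitVec hT hV hconj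
  have hcomplete := PowerLaw.isCompleteSet_range hV
  refine ⟨q + p, ?_, ?_, fun hκ2 => ?_, ?_, ⟨fun k => V (PowerLaw.unitVec k), heig, hcomplete, ?_⟩,
    fun hp => ?_⟩
  · rw [add_sub_cancel_right]
    exact PowerLaw.mem_diagonalClass B (hq.trans_lt ENNReal.ofReal_lt_top).ne
  · rw [hεeq, ENNReal.ofReal_one, one_mul]
    refine hqn.trans (ENNReal.ofReal_le_ofReal ?_)
    calc C * ε ^ 2 = C * ε * ε := by ring
      _ ≤ C * C⁻¹ * ε := by gcongr
      _ = ε := by rw [mul_inv_cancel₀ hC.ne', one_mul]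
  · rw [hεeq, ENNReal.ofReal_one, one_mul,
      ENNReal.ofReal_rpow_of_nonneg hε (one_div_pos.2 (by linarith)).le]
    exact hqn.trans (ENNReal.ofReal_le_ofReal (PowerLaw.mul_sq_le_rpow hC hε hκ2 h3))
  · refine hcomplete.mono (Submodule.span_mono ?_)
    rintro _ ⟨k, rfl⟩
    exact ⟨_, heig k⟩
  · intro i k
    have := PowerLaw.norm_mat_apply_le (b := a - τ - 11 * δ) hVn i k
    convert this using 3
    rw [ha]
    ring
  · have hp' : ∀ i, ((q + p) i).im = 0 := fun i => by
      rw [Pi.add_apply, Complex.add_im, hreal hp i, hp i, add_zero]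
    refine ⟨hp', ?_⟩
    -- The spectrum is the closure in `ℂ` of the eigenvalues; these are real and `ℝ` is closed in
    -- `ℂ`, so the closure may be taken in `ℝ`.
    rw [PowerLaw.operatorSpectrum_hamiltonian hT (fun i j => by
      rw [hT, hT', PowerLaw.hoppingMatrix, PowerLaw.hoppingMatrix, neg_sub]) hV hV' hconj hconj',
      ← Complex.isUniformEmbedding_ofReal.isClosedEmbedding.closure_image_eq, ← Set.range_comp]
    congr 2
    funext i
    exact Complex.ext rfl (hp' i)
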